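/- All objects are smooth. Let $\mathcal M$ be a finite-dimensional smooth manifold, $\pi$ a Poisson bivector on $\mathcal M$ with $\pi^\sharp:T^*\mathcal M\to T\mathcal M$, $\langle\beta,\pi^\sharp\alpha\rangle=\pi(\alpha,\beta)$, and $N:T\mathcal M\to T\mathcal M$ a $(1,1)$ tensor field. Put $[X,Y]_N=[NX,Y]+[X,NY]-N[X,Y]$ and $T_N(X,Y)=[NX,NY]-N[X,Y]_N$ (the torsion of $N$). One says that $\pi$ and $N$ are *compatible* if $N\pi^\sharp=\pi^\sharp N^*$ and $$L_{\pi^\sharp\alpha}(N)X-\pi^\sharp L_X(N^*\alpha)+\pi^\sharp L_{NX}\alpha=0$$ for all 1-forms $\alpha$ and vector fields $X$. $(\mathcal M,\pi,N)$ is a *Poisson-Nijenhuis manifold* if $\pi$ and $N$ are compatible and $T_N=0$. For a 3-form $\phi$, $(\mathcal M,\pi,N,\phi)$ is a *Poisson quasi-Nijenhuis manifold* if $\pi$ and $N$ are compatible, $\phi$ and $i_N\phi$ are closed, where $(i_N\phi)(X,Y,Z)=\phi(NX,Y,Z)+\phi(X,NY,Z)+\phi(X,Y,NZ)$, and $T_N(X,Y)=\pi^\sharp(\phi(X,Y,\cdot))$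 for all vector fields $X,Y$. For a $q$-form $\alpha$ let $$(\mathrm d_N\alpha)(X_0,\dots,X_q)=\sum_{j=0}^q(-1)^jL_{NX_j}\bigl(\alpha(X_0,\dots,\widehat{X}_j,\dots,X_q)\bigr)+\sum_{i<j}(-1)^{i+j}\alpha([X_i,X_j]_N,X_0,\dots,\widehat X_i,\dots,\widehat X_j,\dots,X_q).$$ Let $[\cdot,\cdot]_\pi$ be the Koszul bracket of forms, $$[\eta,\eta']_\pi=(-1)^{q}\bigl(\partial_\pi(\eta\wedge\eta')-\partial_\pi\eta\wedge\eta'-(-1)^{q}\,\eta\wedge\partial_\pi\eta'\bigr),\qquad \partial_\pi=i_\pi\circ\mathrm d-\mathrm d\circ i_\pi ,$$ for a $q$-form $\eta$, where $i_{X\wedge Y}\omega=\omega(X,Y,\cdot,\dots,\cdot)$; equivalently, the unique extension to all forms of the bracket $[\alpha,\beta]_\pi=L_{\pi^\sharp\alpha}\beta-L_{\pi^\sharp\beta}\alpha-\mathrm d\langle\beta,\pi^\sharp\alpha\rangle$ of 1-forms such that, for a $q$-form $\eta$ and a $q'$-form $\eta'$, $[\eta,\eta']_\pi$ is a $(q+q'-1)$-form,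 $[\eta,\eta']_\pi=-(-1)^{(q-1)(q'-1)}[\eta',\eta]_\pi$, $[\alpha,f]_\pi=\langle \mathrm df,\pi^\sharp\alpha\rangle$ for 1-forms $\alpha$ and functions $f$, and $[\eta,\cdot]_\pi$ is a derivation of degree $q-1$ of the wedge product. **Theorem.** Let $(\mathcal M,\pi,N)$ be a Poisson-Nijenhuis manifold and let $\Omega$ be a closed 2-form. Set $\widehat N=N+\pi^\sharp\,\Omega^\flat$, where $\Omega^\flat(X)=\Omega(X,\cdot)$, and $$\phi=\mathrm d_N\Omega+\tfrac12[\Omega,\Omega]_\pi .$$ Then $(\mathcal M,\pi,\widehat N,\phi)$ is a Poisson quasi-Nijenhuis manifold. In particular, if $\phi=0$, then $(\mathcal M,\pi,\widehat N)$ is a Poisson-Nijenhuis manifold. -/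

import Mathlib

open scoped Manifold ContDiff Bundle
open VectorField

noncomputable section

namespace PoissonNijenhuis

variable {n : ℕ} {M : Type*} [TopologicalSpace M] [ChartedSpace (EuclideanSpace ℝ (Fin n)) M]

/-! ### Tensor fields

`M` is a manifold modelled on `ℝⁿ`. Tensor fields are families indexed by the points of `M`;
smoothness is a separate predicate. For tensors other than vector fields it is tested by evaluation
on smooth vector fields and smooth 1-forms. -/

/-- The tangent space of `M` at `x`. -/
abbrev Tan (n : ℕ) {M : Type*} [TopologicalSpace M] [ChartedSpace (EuclideanSpace ℝ (Fin n)) M]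
    (x : M) : Type :=
  TangentSpace (𝓡 n) x

instance finiteDimensional_tangentSpace (x : M) : FiniteDimensional ℝ (Tan n x) :=
  inferInstanceAs (FiniteDimensional ℝ (EuclideanSpace ℝ (Fin n)))

variable (n M) in
/-- Vector fields. -/
abbrev VField : Type _ := ∀ x : M, Tan n x

variable (n M) in
/-- 1-forms, as fields of covectors. -/
abbrev OneForm : Type _ := ∀ x : M, Module.Dual ℝ (Tan n x)

variable (n M) in
/-- `p`-forms. -/
abbrev Form (p : ℕ) : Type _ := ∀ x : M, (Tan n x) [⋀^Fin p]→ₗ[ℝ] ℝ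

variable (n M) in
/-- Tensor fields of type `(1,1)`, as fields of endomorphisms of the tangent spaces. -/
abbrev Endo : Type _ := ∀ x : M, Tan n x →ₗ[ℝ] Tan n x

variable (n M) in
/-- Fields of bilinear forms on the cotangent spaces (a bivector field is an alternating one). -/
abbrev Biv : Type _ := ∀ x : M, LinearMap.BilinForm ℝ (Module.Dual ℝ (Tan n x))

/-! ### Pointwise operations -/

/-- An alternating 1-linear form is a covector. -/
def toCovector (x : M) : (Tan n x) [⋀^Fin 1]→ₗ[ℝ] ℝ →ₗ[ℝ] Module.Dual ℝ (Tan n x) where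
  toFun η := (AlternatingMap.ofSubsingleton ℝ (Tan n x) ℝ (0 : Fin 1)).symm η
  map_add' _ _ := rfl
  map_smul' _ _ := rfl

/-- `P^♯ : T*M → TM`, defined by `⟨β, P^♯ α⟩ = P(α, β)`. -/
def sharp (P : Biv n M) (x : M) : Module.Dual ℝ (Tan n x) →ₗ[ℝ] Tan n x :=
  (Module.evalEquiv ℝ (Tan n x)).symm.toLinearMap ∘ₗ P x

/-- `Ω^♭ : TM → T*M`, defined by `Ω^♭(X) = i_X Ω = Ω(X, ·)`. -/
def flat (Ω : Form n M 2) (x : M) : Tan n x →ₗ[ℝ] Module.Dual ℝ (Tan n x) :=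
  toCovector x ∘ₗ (Ω x).curryLeft

/-- The covector `i_{u ∧ v} φ = φ(u, v, ·)`. -/
def contract₂ (φ : Form n M 3) (x : M) (u v : Tan n x) : Module.Dual ℝ (Tan n x) :=
  toCovector x (((φ x).curryLeft u).curryLeft v)

/-- The deformed tensor field `N̂ = N + P^♯ Ω^♭`. -/
def deform (P : Biv n M) (N : Endo n M) (Ω : Form n M 2) : Endo n M :=
  fun x => N x + sharp P x ∘ₗ flat Ω x

/-- `(i_N η)(X₁, …, X_p) = ∑ᵢ η(X₁, …, N Xᵢ, …, X_p)`. -/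
def insertEndo {p : ℕ} (N : Endo n M) (η : Form n M p) : Form n M p := fun x =>
  { ∑ i : Fin p, (η x).toMultilinearMap.compLinearMap
      (fun j => if j = i then N x else LinearMap.id) with
    map_eq_zero_of_eq' := by
      intro v i j hij hne
      have key : ∀ k : Fin p, (fun l => (if l = k then N x else LinearMap.id) (v l)) =
          Function.update v k (N x (v k)) := by
        intro k
        funext l
        by_cases h : l = k
        · subst h; simp
        · simp [h]
      simp only [MultilinearMap.toFun_eq_coe, sum_apply,
        MultilinearMap.compLinearMap_apply, key, AlternatingMap.coe_multilinearMap]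
      rw [← Finset.add_sum_erase _ _ (Finset.mem_univ i),
        ← Finset.add_sum_erase _ _ (Finset.mem_erase.2 ⟨hne.symm, Finset.mem_univ j⟩),
        Finset.sum_eq_zero, add_zero]
      · have hs : Function.update v j (N x (v j)) =
            (Function.update v i (N x (v i))) ∘ Equiv.swap i j := by
          funext l
          by_cases hi : l = i
          · subst hi; simp [hne, hne.symm, hij]
          by_cases hj : l = j
          · subst hj; simp [hij]
          · simp [hi, hj, Equiv.swap_apply_of_ne_of_ne hi hj]
        rw [hs, AlternatingMap.map_swap _ _ hne, add_neg_cancel]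
      · intro k hk
        simp only [Finset.mem_erase, Finset.mem_univ, and_true, ne_eq] at hk
        refine (η x).map_eq_zero_of_eq _ (i := i) (j := j) ?_ hne
        simp [Ne.symm hk.1, Ne.symm hk.2, hij] }

/-- The wedge product, normalized by `(α ∧ β)(X, Y) = α(X) β(Y) - α(Y) β(X)` for 1-forms
(a signed sum over shuffles). -/
def wedge {p q : ℕ} (α : Form n M p) (β : Form n M q) : Form n M (p + q) := fun x =>
  ((LinearMap.mul' ℝ ℝ).compAlternatingMap ((α x).domCoprod (β x))).domDomCongr finSumFinEquiv

/-- The contraction `i_P` of a form of degree `≥ 2` with a bivector field, the linear extension of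
`i_{X ∧ Y} η = η(X, Y, ·, …, ·)`: in any basis `e` of the tangent space,
`i_P η = ½ ∑ᵢⱼ Pⁱʲ η(eᵢ, eⱼ, ·, …, ·)`. -/
def contractBiv {k : ℕ} (P : Biv n M) (η : Form n M (k + 2)) : Form n M k := fun x =>
  let e := Module.finBasis ℝ (Tan n x)
  (1 / 2 : ℝ) • ∑ i, ∑ j, P x (e.coord i) (e.coord j) • ((η x).curryLeft (e i)).curryLeft (e j)

/-! ### Differential operations -/

/-- The value at `x` of the directional derivative `L_X f`. -/
def dirDeriv (X : VField n M) (f : M → ℝ) (x : M) : ℝ :=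
  mvfderiv (𝓡 n) f x (X x)

/-- The differential of a function. -/
def diff (n : ℕ) {M : Type*} [TopologicalSpace M] [ChartedSpace (EuclideanSpace ℝ (Fin n)) M]
    (f : M → ℝ) : OneForm n M :=
  fun x => (mvfderiv (𝓡 n) f x).toLinearMap

/-- The deformed bracket `[X, Y]_N = [NX, Y] + [X, NY] - N[X, Y]`. -/
def bracketN (N : Endo n M) (X Y : VField n M) : VField n M := fun x =>
  mlieBracket (𝓡 n) (fun y => N y (X y)) Y x + mlieBracket (𝓡 n) X (fun y => N y (Y y)) x
    - N x (mlieBracket (𝓡 n) X Y x)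

/-- The Nijenhuis torsion `T_N(X, Y) = [NX, NY] - N([NX, Y] + [X, NY] - N[X, Y])`. -/
def torsion (N : Endo n M) (X Y : VField n M) : VField n M := fun x =>
  mlieBracket (𝓡 n) (fun y => N y (X y)) (fun y => N y (Y y)) x - N x (bracketN N X Y x)

/-- The second sum in the formula for `d_N α`:
`∑_{i<j} (-1)^{i+j} α([Xᵢ, Xⱼ]_N, X₀, …, X̂ᵢ, …, X̂ⱼ, …, X_q)`, which is empty for `q = 0`.
For `q = r + 1` the pair `i ≤ j` of indices in `Fin (r + 1)` stands for the pair `i < j + 1`. -/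
def bracketSum (N : Endo n M) : {q : ℕ} → Form n M q → (Fin (q + 1) → VField n M) → M → ℝ
  | 0, _, _ => fun _ => 0
  | r + 1, α, X => fun x =>
    ∑ i : Fin (r + 1), ∑ j ≥ i, (-1 : ℝ) ^ ((i : ℕ) + ((j : ℕ) + 1)) *
      α x (Matrix.vecCons (bracketN N (X i.castSucc) (X j.succ) x)
        (j.removeNth (i.castSucc.removeNth (fun k => X k x))))

/-- The right-hand side of the formula
`(d_N α)(X₀, …, X_q) = ∑ⱼ (-1)ʲ L_{N Xⱼ} (α(X₀, …, X̂ⱼ, …, X_q))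
  + ∑_{i<j} (-1)^{i+j} α([Xᵢ, Xⱼ]_N, X₀, …, X̂ᵢ, …, X̂ⱼ, …, X_q)`. -/
def cartanSum {q : ℕ} (N : Endo n M) (α : Form n M q) (X : Fin (q + 1) → VField n M)
    (x : M) : ℝ :=
  ∑ j : Fin (q + 1), (-1 : ℝ) ^ (j : ℕ) *
      dirDeriv (fun y => N y (X j y)) (fun y => α y (j.removeNth (fun k => X k y))) x
    + bracketSum N α X x

/-! ### Smoothness -/

variable [IsManifold (𝓡 n) ∞ M]

/-- Smooth vector fields. -/
def SmoothV (X : VField n M) : Prop :=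
  ContMDiff (𝓡 n) (𝓡 n).tangent ∞ (fun x => (⟨x, X x⟩ : TangentBundle (𝓡 n) M))

/-- Smooth real functions. -/
def SmoothF (n : ℕ) {M : Type*} [TopologicalSpace M] [ChartedSpace (EuclideanSpace ℝ (Fin n)) M]
    (f : M → ℝ) : Prop :=
  ContMDiff (𝓡 n) 𝓘(ℝ, ℝ) ∞ f

/-- Smooth 1-forms. -/
def SmoothOne (α : OneForm n M) : Prop :=
  ∀ X : VField n M, SmoothV X → SmoothF n (fun x => α x (X x))

/-- Smooth `p`-forms. -/
def SmoothForm {p : ℕ} (η : Form n M p) : Prop :=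
  ∀ X : Fin p → VField n M, (∀ i, SmoothV (X i)) → SmoothF n (fun x => η x (fun i => X i x))

/-- Smooth `(1,1)` tensor fields. -/
def SmoothEndo (N : Endo n M) : Prop :=
  ∀ X : VField n M, SmoothV X → SmoothV (fun x => N x (X x))

/-- Smooth fields of bilinear forms on the cotangent spaces. -/
def SmoothBiv (P : Biv n M) : Prop :=
  ∀ α β : OneForm n M, SmoothOne α → SmoothOne β → SmoothF n (fun x => P x (α x) (β x))

open Classical in
/-- The differential `d_N` deformed by the `(1,1)` tensor field `N`: `d_N α` is the form whose
values on smooth vector fields are given by the formula above. -/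
def dN {q : ℕ} (N : Endo n M) (α : Form n M q) : Form n M (q + 1) := fun x =>
  if h : ∃ β : (Tan n x) [⋀^Fin (q + 1)]→ₗ[ℝ] ℝ,
      ∀ X : Fin (q + 1) → VField n M, (∀ i, SmoothV (X i)) →
        β (fun i => X i x) = cartanSum N α X x
  then h.choose else 0

/-- The Cartan (exterior) differential, which is `d_N` for `N = Id`. -/
def extd {q : ℕ} (α : Form n M q) : Form n M (q + 1) :=
  dN (fun _ => LinearMap.id) α

open Classical in
/-- The Lie derivative of a 1-form: `L_X α` is the 1-form such that
`(L_X α)(Y) = L_X (α(Y)) - α([X, Y])` for all smooth vector fields `Y`. -/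
def lieOne (X : VField n M) (α : OneForm n M) : OneForm n M := fun x =>
  if h : ∃ ξ : Module.Dual ℝ (Tan n x), ∀ Y : VField n M, SmoothV Y →
      ξ (Y x) = dirDeriv X (fun y => α y (Y y)) x - α x (mlieBracket (𝓡 n) X Y x)
  then h.choose else 0

/-- The operator `∂_P = i_P ∘ d - d ∘ i_P` on forms of degree `≥ 2`. -/
def koszulOp {k : ℕ} (P : Biv n M) (η : Form n M (k + 2)) : Form n M (k + 1) :=
  contractBiv P (extd η) - extd (contractBiv P η)

/-- The Koszul bracket of two 2-forms. The Koszul bracket of a `q`-form and a `q'`-form is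
`[η, η']_P = (-1)^q (∂_P(η ∧ η') - ∂_P η ∧ η' - (-1)^q η ∧ ∂_P η')`. It is the graded-symmetric
biderivation of the wedge product with `[α, f]_P = ⟨df, P^♯ α⟩` and
`[α, β]_P = L_{P^♯ α} β - L_{P^♯ β} α - d⟨β, P^♯ α⟩` for functions `f` and 1-forms `α`, `β`. -/
def koszul (P : Biv n M) (η η' : Form n M 2) : Form n M 3 :=
  koszulOp (k := 2) P (wedge η η') - wedge (koszulOp (k := 0) P η) η'
    - wedge η (koszulOp (k := 0) P η')

/-! ### Poisson, Poisson-Nijenhuis and Poisson quasi-Nijenhuis structures -/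

/-- `{f, g} = P(df, dg)`. -/
def poissonBracket (P : Biv n M) (f g : M → ℝ) : M → ℝ :=
  fun x => P x (diff n f x) (diff n g x)

/-- `P` is a Poisson bivector: smooth, skew-symmetric, and its bracket satisfies the Jacobi
identity. -/
structure IsPoisson (P : Biv n M) : Prop where
  smooth : SmoothBiv P
  alt : ∀ x, (P x).IsAlt
  jacobi : ∀ f g h : M → ℝ, SmoothF n f → SmoothF n g → SmoothF n h → ∀ x,
    poissonBracket P (poissonBracket P f g) h x + poissonBracket P (poissonBracket P g h) f x
      + poissonBracket P (poissonBracket P h f) g x = 0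

/-- `P` and `N` are compatible: `N P^♯ = P^♯ N*` and
`L_{P^♯ α}(N) X - P^♯ L_X (N* α) + P^♯ L_{NX} α = 0` for all 1-forms `α` and vector fields `X`,
where `L_Y(N) X = [Y, NX] - N[Y, X]`. -/
structure Compatible (P : Biv n M) (N : Endo n M) : Prop where
  comm : ∀ x, N x ∘ₗ sharp P x = sharp P x ∘ₗ (N x).dualMap
  lie : ∀ (α : OneForm n M) (X : VField n M), SmoothOne α → SmoothV X → ∀ x,
    (mlieBracket (𝓡 n) (fun y => sharp P y (α y)) (fun y => N y (X y)) x
        - N x (mlieBracket (𝓡 n) (fun y => sharp P y (α y)) X x))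
      - sharp P x (lieOne X (fun y => (N y).dualMap (α y)) x)
      + sharp P x (lieOne (fun y => N y (X y)) α x) = 0

/-- `(M, P, N)` is a Poisson-Nijenhuis manifold. -/
structure IsPN (P : Biv n M) (N : Endo n M) : Prop where
  poisson : IsPoisson P
  smooth : SmoothEndo N
  compatible : Compatible P N
  torsion_eq_zero : ∀ X Y : VField n M, SmoothV X → SmoothV Y → ∀ x, torsion N X Y x = 0

/-- `(M, P, N, φ)` is a Poisson quasi-Nijenhuis manifold. -/
structure IsPqN (P : Biv n M) (N : Endo n M) (φ : Form n M 3) : Prop where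
  poisson : IsPoisson P
  smooth : SmoothEndo N
  smooth_form : SmoothForm φ
  compatible : Compatible P N
  closed : extd φ = 0
  closed_insert : extd (insertEndo N φ) = 0
  torsion_eq : ∀ X Y : VField n M, SmoothV X → SmoothV Y → ∀ x,
    torsion N X Y x = sharp P x (contract₂ φ x (X x) (Y x))

end PoissonNijenhuis

end

open PoissonNijenhuis

/-!
Write `A = P^♯ Ω^♭`, so that the deformed tensor field is `N + A`. The proof reduces everything to
the exactness of a few forms and to one identity for closed 2-forms.

*Compatibility* is additive in the tensor field (`Compatible.add`). For a Poisson bivector, `P^♯`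
carries the bracket of 1-forms to the bracket of vector fields (`IsPoisson.lie_sharp`, which
extends the Jacobi identity from exact forms), and with this the compatibility of `P` and `A`
becomes the vanishing of `P^♯ (dΩ(P^♯ α, X, ·))` (`IsPoisson.compatible_sharpFlat`).

*Torsion.* In the same way `T_A(X, Y) = P^♯ (-½ (d i_A Ω)(X, Y, ·))`
(`IsPoisson.torsion_sharpFlat`), and the part of the torsion of `N + A` which mixes `N` and `A` is
`P^♯ ((d_N Ω)(X, Y, ·))`, by the compatibility of `P` and `N` (`Compatible.torsion_mixed`).

*The form.* Since `Ω` is closed, `d_N Ω = -d i_N Ω` (`dN_eq_neg`). Moreover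
`[Ω, Ω]_P = -d i_A Ω` (`IsPoisson.koszul_self`): from `i_P (Ω ∧ Ω) = 2 (i_P Ω) Ω + i_A Ω` and
`d (Ω ∧ Ω) = 0`, the terms with `d (i_P Ω) ∧ Ω` in the Koszul bracket cancel. Hence
`φ = -d i_N Ω - ½ d i_A Ω` is exact, and `T_{N + A} = P^♯ φ`.

*Closedness of `i_{N + A} φ`.* For any `K`, the closed form `Ω` satisfies
`i_K d i_K Ω = d Θ_K + Ω(T_K(·, ·), ·)` (cyclic sum), where
`Θ_K(X, Y) = Ω(K²X, Y) + Ω(KX, KY) + Ω(X, K²Y)` (`insertEndo_extd_insertEndo`); if `T_K = P^♯ ψ`,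
the last term is `i_A ψ`. Applied to `K = N`, `A`, `N + A` this gives three linear equations,
which show that `i_{N + A} φ` is the differential of `-½ Θ_N - ½ Θ_{N + A} + ⅙ Θ_A`.

The differentials and Lie derivatives of the statement are defined by the values they take on
smooth vector fields. That such tensors exist is the content of `extd_apply`, proved in a chart
where `d` is the exterior derivative of Mathlib, and of `dN_eq` and `lieOne_apply`.
-/

noncomputable section

open scoped Topology
open PoissonNijenhuis Filter

namespace PoissonNijenhuis

variable {n : ℕ} {M : Type*} [TopologicalSpace M] [ChartedSpace (EuclideanSpace ℝ (Fin n)) M]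

/-! ### Smooth functions, smooth vector fields and their calculus -/

section Calculus

theorem SmoothF.mdifferentiableAt {f : M → ℝ} (hf : SmoothF n f) (x : M) :
    MDifferentiableAt (𝓡 n) 𝓘(ℝ, ℝ) f x :=
  ContMDiff.mdifferentiable hf (by simp) x

theorem smoothF_const (c : ℝ) : SmoothF n (fun _ : M => c) := contMDiff_const

theorem SmoothF.add {f g : M → ℝ} (hf : SmoothF n f) (hg : SmoothF n g) :
    SmoothF n (fun x => f x + g x) := ContMDiff.add hf hg

theorem SmoothF.sub {f g : M → ℝ} (hf : SmoothF n f) (hg : SmoothF n g) :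
    SmoothF n (fun x => f x - g x) := ContMDiff.sub hf hg

theorem SmoothF.mul {f g : M → ℝ} (hf : SmoothF n f) (hg : SmoothF n g) :
    SmoothF n (fun x => f x * g x) := ContMDiff.mul hf hg

theorem smoothF_sum {ι : Type*} (s : Finset ι) {f : ι → M → ℝ}
    (hf : ∀ i ∈ s, SmoothF n (f i)) : SmoothF n (fun x => ∑ i ∈ s, f i x) :=
  contMDiff_finsetSum hf

/-- Smoothness of functions is a local property. -/
theorem smoothF_of_eventuallyEq {f : M → ℝ}
    (h : ∀ x, ∃ g : M → ℝ, SmoothF n g ∧ f =ᶠ[𝓝 x] g) : SmoothF n f := fun x => by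
  obtain ⟨g, hg, hfg⟩ := h x
  exact (hg x).congr_of_eventuallyEq hfg

theorem dirDeriv_congr {f g : M → ℝ} {x : M} (X : VField n M) (h : f =ᶠ[𝓝 x] g) :
    dirDeriv X f x = dirDeriv X g x := by
  have h1 : mfderiv (𝓡 n) 𝓘(ℝ, ℝ) f x = mfderiv (𝓡 n) 𝓘(ℝ, ℝ) g x := h.mfderiv_eq
  exact congrArg (fun L : EuclideanSpace ℝ (Fin n) →L[ℝ] ℝ => L (X x)) h1

theorem dirDeriv_congr_left {X Y : VField n M} {x : M} (f : M → ℝ) (h : X x = Y x) :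
    dirDeriv X f x = dirDeriv Y f x := by
  simp only [dirDeriv, h]

theorem dirDeriv_const (X : VField n M) (c : ℝ) (x : M) : dirDeriv X (fun _ => c) x = 0 := by
  simp only [dirDeriv, mvfderiv_const]; rfl

theorem dirDeriv_add (X : VField n M) {f g : M → ℝ} (hf : SmoothF n f) (hg : SmoothF n g)
    (x : M) : dirDeriv X (fun y => f y + g y) x = dirDeriv X f x + dirDeriv X g x := by
  simp only [dirDeriv, mvfderiv_fun_add (hf.mdifferentiableAt x) (hg.mdifferentiableAt x)]; rfl

theorem dirDeriv_sub (X : VField n M) {f g : M → ℝ} (hf : SmoothF n f) (hg : SmoothF n g)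
    (x : M) : dirDeriv X (fun y => f y - g y) x = dirDeriv X f x - dirDeriv X g x := by
  simp only [dirDeriv, mvfderiv_fun_sub (hf.mdifferentiableAt x) (hg.mdifferentiableAt x)]; rfl

theorem dirDeriv_neg (X : VField n M) (f : M → ℝ) (x : M) :
    dirDeriv X (fun y => -f y) x = -dirDeriv X f x := by
  simp only [dirDeriv, mvfderiv_fun_neg]; rfl

theorem dirDeriv_mul (X : VField n M) {f g : M → ℝ} (hf : SmoothF n f) (hg : SmoothF n g)
    (x : M) : dirDeriv X (fun y => f y * g y) x = f x * dirDeriv X g x + g x * dirDeriv X f x := by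
  simp only [dirDeriv, mvfderiv_fun_mul (hf.mdifferentiableAt x) (hg.mdifferentiableAt x)]; rfl

theorem dirDeriv_const_mul (X : VField n M) (c : ℝ) {f : M → ℝ} (hf : SmoothF n f)
    (x : M) : dirDeriv X (fun y => c * f y) x = c * dirDeriv X f x := by
  rw [dirDeriv_mul X (smoothF_const c) hf, dirDeriv_const]; ring

theorem dirDeriv_sum {ι : Type*} (X : VField n M) (s : Finset ι) {f : ι → M → ℝ}
    (hf : ∀ i ∈ s, SmoothF n (f i)) (x : M) :
    dirDeriv X (fun y => ∑ i ∈ s, f i y) x = ∑ i ∈ s, dirDeriv X (f i) x := by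
  classical
  induction s using Finset.induction_on with
  | empty => simpa using dirDeriv_const X 0 x
  | insert a s ha ih =>
    have h1 := fun i hi => hf i (Finset.mem_insert_of_mem hi)
    simp only [Finset.sum_insert ha]
    rw [dirDeriv_add X (hf a (Finset.mem_insert_self a s)) (smoothF_sum s h1), ih h1]

theorem dirDeriv_add_left (X Y : VField n M) (f : M → ℝ) (x : M) :
    dirDeriv (fun y => X y + Y y) f x = dirDeriv X f x + dirDeriv Y f x :=
  map_add (mvfderiv (𝓡 n) f x) (X x) (Y x)

theorem dirDeriv_smul_left (g : M → ℝ) (X : VField n M) (f : M → ℝ) (x : M) :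
    dirDeriv (fun y => g y • X y) f x = g x * dirDeriv X f x :=
  map_smul (mvfderiv (𝓡 n) f x) (g x) (X x)

theorem diff_apply (f : M → ℝ) (X : VField n M) (x : M) : diff n f x (X x) = dirDeriv X f x := rfl

theorem lie_swap (X Y : VField n M) (x : M) :
    mlieBracket (𝓡 n) X Y x = -mlieBracket (𝓡 n) Y X x := mlieBracket_swap_apply

variable [IsManifold (𝓡 n) ∞ M]

theorem SmoothV.mdifferentiableAt {X : VField n M} (hX : SmoothV X) (x : M) :
    MDifferentiableAt (𝓡 n) (𝓡 n).tangent
      (fun x => (⟨x, X x⟩ : TangentBundle (𝓡 n) M)) x :=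
  ContMDiff.mdifferentiable hX (by simp) x

theorem SmoothV.add {X Y : VField n M} (hX : SmoothV X) (hY : SmoothV Y) :
    SmoothV (fun x => X x + Y x) := ContMDiff.add_section hX hY

theorem SmoothV.sub {X Y : VField n M} (hX : SmoothV X) (hY : SmoothV Y) :
    SmoothV (fun x => X x - Y x) := ContMDiff.sub_section hX hY

theorem SmoothV.smul {f : M → ℝ} {X : VField n M} (hf : SmoothF n f) (hX : SmoothV X) :
    SmoothV (fun x => f x • X x) := ContMDiff.smul_section hf hX

theorem smoothV_sum {ι : Type*} (s : Finset ι) {X : ι → VField n M}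
    (hX : ∀ i ∈ s, SmoothV (X i)) : SmoothV (fun x => ∑ i ∈ s, X i x) :=
  ContMDiff.sum_section hX

/-- Smoothness of vector fields is a local property. -/
theorem smoothV_of_eventuallyEq {X : VField n M}
    (h : ∀ x, ∃ Y : VField n M, SmoothV Y ∧ X =ᶠ[𝓝 x] Y) : SmoothV X := fun x => by
  obtain ⟨Y, hY, hXY⟩ := h x
  refine (hY x).congr_of_eventuallyEq ?_
  filter_upwards [hXY] with y hy
  rw [hy]

theorem SmoothV.lie {X Y : VField n M} (hX : SmoothV X) (hY : SmoothV Y) :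
    SmoothV (mlieBracket (𝓡 n) X Y) := by
  have : IsManifold (𝓡 n) ((⊤ : ℕ∞) + 1) M := by
    simpa using (inferInstance : IsManifold (𝓡 n) ∞ M)
  have : IsManifold (𝓡 n) (minSmoothness ℝ 2) M := by
    simp only [minSmoothness_of_isRCLikeNormedField]
    infer_instance
  exact ContDiff.mlieBracket_vectorField (m := ⊤) (n := ⊤) hX hY (by simp)

theorem SmoothV.dirDeriv {X : VField n M} {f : M → ℝ} (hX : SmoothV X) (hf : SmoothF n f) :
    SmoothF n (dirDeriv X f) := by
  have : IsManifold (𝓡 n) 1 M := inferInstance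
  have h1 : ContMDiff (𝓡 n).tangent 𝓘(ℝ, ℝ).tangent ∞ (tangentMap (𝓡 n) 𝓘(ℝ, ℝ) f) :=
    ContMDiff.contMDiff_tangentMap hf (by simp)
  exact (contMDiff_snd_tangentBundle_modelSpace ℝ 𝓘(ℝ, ℝ)).comp (h1.comp hX)

theorem lie_add_left {X Y : VField n M} (hX : SmoothV X) (hY : SmoothV Y) (Z : VField n M)
    (x : M) : mlieBracket (𝓡 n) (fun y => X y + Y y) Z x =
      mlieBracket (𝓡 n) X Z x + mlieBracket (𝓡 n) Y Z x := by
  have : IsManifold (𝓡 n) 2 M := inferInstance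
  exact mlieBracket_add_left (hX.mdifferentiableAt x) (hY.mdifferentiableAt x)

theorem lie_add_right (X : VField n M) {Y Z : VField n M} (hY : SmoothV Y) (hZ : SmoothV Z)
    (x : M) : mlieBracket (𝓡 n) X (fun y => Y y + Z y) x =
      mlieBracket (𝓡 n) X Y x + mlieBracket (𝓡 n) X Z x := by
  have : IsManifold (𝓡 n) 2 M := inferInstance
  exact mlieBracket_add_right (hY.mdifferentiableAt x) (hZ.mdifferentiableAt x)

theorem lie_smul_left {f : M → ℝ} {X : VField n M} (hf : SmoothF n f) (hX : SmoothV X)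
    (Y : VField n M) (x : M) : mlieBracket (𝓡 n) (fun y => f y • X y) Y x =
      -dirDeriv Y f x • X x + f x • mlieBracket (𝓡 n) X Y x := by
  have : IsManifold (𝓡 n) 2 M := inferInstance
  exact mlieBracket_smul_left (hf.mdifferentiableAt x) (hX.mdifferentiableAt x)

end Calculus

/-! ### Vector fields in a chart -/

section Chart

variable [IsManifold (𝓡 n) ∞ M]

/-- The representative of a vector field in the preferred chart at `x`. -/
def inChart (x : M) (X : VField n M) : EuclideanSpace ℝ (Fin n) → EuclideanSpace ℝ (Fin n) :=
  mpullbackWithin 𝓘(ℝ, EuclideanSpace ℝ (Fin n)) (𝓡 n) (extChartAt (𝓡 n) x).symm X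
    (Set.range (𝓡 n))

theorem contDiffAt_comp_chart_symm (x : M) {f : M → ℝ} (hf : SmoothF n f) :
    ContDiffAt ℝ ∞ (f ∘ (extChartAt (𝓡 n) x).symm) (extChartAt (𝓡 n) x x) := by
  have h1 := contMDiffWithinAt_extChartAt_symm_range (I := 𝓡 n) (n := ∞) x
    (mem_extChartAt_target (I := 𝓡 n) x)
  have h2 := ContMDiffAt.comp_contMDiffWithinAt (I := 𝓘(ℝ, EuclideanSpace ℝ (Fin n)))
    (extChartAt (𝓡 n) x x) (hf _) h1
  rw [contMDiffWithinAt_iff_contDiffWithinAt, (𝓡 n).range_eq_univ, contDiffWithinAt_univ] at h2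
  exact h2

theorem differentiableAt_inChart (x : M) {X : VField n M} (hX : SmoothV X) :
    DifferentiableAt ℝ (inChart x X) (extChartAt (𝓡 n) x x) := by
  have h : DifferentiableWithinAt ℝ (inChart x X) _ (extChartAt (𝓡 n) x x) :=
    MDifferentiableWithinAt.differentiableWithinAt_mpullbackWithin_vectorField (s := Set.univ)
    (hX.mdifferentiableAt x).mdifferentiableWithinAt
  rwa [Set.preimage_univ, (𝓡 n).range_eq_univ, Set.univ_inter, differentiableWithinAt_univ] at h

theorem fderiv_comp_chart_symm (x : M) {f : M → ℝ} (hf : SmoothF n f) (X : VField n M)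
    {t : EuclideanSpace ℝ (Fin n)} (ht : t ∈ (extChartAt (𝓡 n) x).target) :
    fderiv ℝ (f ∘ (extChartAt (𝓡 n) x).symm) t (inChart x X t) =
      dirDeriv X f ((extChartAt (𝓡 n) x).symm t) := by
  have h1 := (contMDiffWithinAt_extChartAt_symm_range (I := 𝓡 n) (n := ∞) x
    ht).mdifferentiableWithinAt (by simp)
  have h2 := HasMFDerivAt.comp_hasMFDerivWithinAt t (hf.mdifferentiableAt _).hasMFDerivAt
    h1.hasMFDerivWithinAt
  obtain ⟨L, hL⟩ : ∃ L : EuclideanSpace ℝ (Fin n) →L[ℝ] ℝ,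
      L = (mfderiv (𝓡 n) 𝓘(ℝ, ℝ) f ((extChartAt (𝓡 n) x).symm t)).comp
        (mfderivWithin 𝓘(ℝ, EuclideanSpace ℝ (Fin n)) (𝓡 n) (extChartAt (𝓡 n) x).symm
          (Set.range (𝓡 n)) t) := ⟨_, rfl⟩
  have h3 : HasFDerivWithinAt (f ∘ (extChartAt (𝓡 n) x).symm) L (Set.range (𝓡 n)) t := by
    rw [hL]; exact HasMFDerivWithinAt.hasFDerivWithinAt h2
  rw [(𝓡 n).range_eq_univ, hasFDerivWithinAt_univ] at h3
  rw [h3.fderiv, hL]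
  have h4 := isInvertible_mfderivWithin_extChartAt_symm (I := 𝓡 n) ht
  exact congrArg (mvfderiv (𝓡 n) f ((extChartAt (𝓡 n) x).symm t))
    (h4.self_apply_inverse (X ((extChartAt (𝓡 n) x).symm t)))

/-- The derivative of `f` in the chart at `x`, as the derivative on `M` along the corresponding tangent
vector. -/
theorem mvfderiv_chart_inverse (x : M) {f : M → ℝ} (hf : SmoothF n f)
    (w : EuclideanSpace ℝ (Fin n)) :
    mvfderiv (𝓡 n) f x ((mfderiv (𝓡 n) 𝓘(ℝ, EuclideanSpace ℝ (Fin n))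
      (extChartAt (𝓡 n) x) x).inverse w) =
      fderiv ℝ (f ∘ (extChartAt (𝓡 n) x).symm) (extChartAt (𝓡 n) x x) w := by
  have h1 := (contDiffAt_comp_chart_symm x hf).differentiableAt (by simp)
  have h2 := mdifferentiableAt_extChartAt (I := 𝓡 n) (mem_chart_source (EuclideanSpace ℝ (Fin n)) x)
  have h3 := HasMFDerivAt.comp x h1.hasFDerivAt.hasMFDerivAt h2.hasMFDerivAt
  have h4 : (f ∘ (extChartAt (𝓡 n) x).symm) ∘ (extChartAt (𝓡 n) x) =ᶠ[𝓝 x] f := by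
    filter_upwards [extChartAt_source_mem_nhds (I := 𝓡 n) x] with y hy
    exact congrArg f ((extChartAt (𝓡 n) x).left_inv hy)
  have h5 := (h3.congr_of_eventuallyEq h4.symm).mfderiv
  have h6 := isInvertible_mfderiv_extChartAt (I := 𝓡 n) (mem_extChartAt_source (I := 𝓡 n) x)
  have h7 := congrArg (fun L : EuclideanSpace ℝ (Fin n) →L[ℝ] ℝ =>
    L ((mfderiv (𝓡 n) 𝓘(ℝ, EuclideanSpace ℝ (Fin n)) (extChartAt (𝓡 n) x) x).inverse w)) h5
  refine Eq.trans h7 ?_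
  exact congrArg (fderiv ℝ (f ∘ (extChartAt (𝓡 n) x).symm) (extChartAt (𝓡 n) x x))
    (h6.self_apply_inverse w)

theorem dirDeriv_lie_chart (X Y : VField n M) {f : M → ℝ} (hf : SmoothF n f) (x : M) :
    dirDeriv (mlieBracket (𝓡 n) X Y) f x =
      fderiv ℝ (f ∘ (extChartAt (𝓡 n) x).symm) (extChartAt (𝓡 n) x x)
        (lieBracket ℝ (inChart x X) (inChart x Y) (extChartAt (𝓡 n) x x)) := by
  rw [← mvfderiv_chart_inverse x hf, ← lieBracketWithin_univ]
  have h : Set.univ = (extChartAt (𝓡 n) x).symm ⁻¹' Set.univ ∩ Set.range (𝓡 n) := by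
    rw [Set.preimage_univ, (𝓡 n).range_eq_univ, Set.univ_inter]
  rw [h]
  rfl

/-- The bracket of vector fields is the commutator of the derivations they define. -/
theorem dirDeriv_lie {X Y : VField n M} {f : M → ℝ} (hX : SmoothV X) (hY : SmoothV Y)
    (hf : SmoothF n f) (x : M) :
    dirDeriv (mlieBracket (𝓡 n) X Y) f x =
      dirDeriv X (dirDeriv Y f) x - dirDeriv Y (dirDeriv X f) x := by
  have key : ∀ {U V : VField n M}, SmoothV U → SmoothV V →
      dirDeriv U (dirDeriv V f) x =
        fderiv ℝ (fderiv ℝ (f ∘ (extChartAt (𝓡 n) x).symm)) (extChartAt (𝓡 n) x x)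
          (inChart x U (extChartAt (𝓡 n) x x)) (inChart x V (extChartAt (𝓡 n) x x)) +
        fderiv ℝ (f ∘ (extChartAt (𝓡 n) x).symm) (extChartAt (𝓡 n) x x)
          (fderiv ℝ (inChart x V) (extChartAt (𝓡 n) x x)
            (inChart x U (extChartAt (𝓡 n) x x))) := by
    intro U V hU hV
    have h1 := fderiv_comp_chart_symm x (hV.dirDeriv hf) U (mem_extChartAt_target (I := 𝓡 n) x)
    rw [extChartAt_to_inv] at h1
    have h2 : dirDeriv V f ∘ (extChartAt (𝓡 n) x).symm =ᶠ[𝓝 (extChartAt (𝓡 n) x x)]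
        fun t => fderiv ℝ (f ∘ (extChartAt (𝓡 n) x).symm) t (inChart x V t) := by
      filter_upwards [extChartAt_target_mem_nhds (I := 𝓡 n) x] with t ht
      exact (fderiv_comp_chart_symm x hf V ht).symm
    have h3 : DifferentiableAt ℝ (fderiv ℝ (f ∘ (extChartAt (𝓡 n) x).symm))
        (extChartAt (𝓡 n) x x) :=
      ((contDiffAt_comp_chart_symm x hf).fderiv_right (m := 1) (by norm_cast)).differentiableAt
        (by simp)
    rw [← h1, h2.fderiv_eq, fderiv_clm_apply h3 (differentiableAt_inChart x hV)]
    simp [add_comm]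
  have hs := (contDiffAt_comp_chart_symm x hf).isSymmSndFDerivAt
    (by simpa using WithTop.coe_le_coe.2 (le_top : (2 : ℕ∞) ≤ ⊤))
  rw [dirDeriv_lie_chart X Y hf, key hX hY, key hY hX, lieBracket, map_sub,
    hs.eq (inChart x X (extChartAt (𝓡 n) x x)) (inChart x Y (extChartAt (𝓡 n) x x))]
  ring

/-! ### Local coordinates extended to the whole manifold -/

/-- `E` and `ξ` are global smooth vector fields and functions which agree near `x₀` with the
coordinate vector fields and the coordinate functions of the preferred chart at `x₀`. -/
structure IsCoordinates (x₀ : M) (E : Fin n → VField n M) (ξ : Fin n → M → ℝ) : Prop where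
  smoothV : ∀ i, SmoothV (E i)
  smoothF : ∀ i, SmoothF n (ξ i)
  eq_sum : ∀ᶠ x in 𝓝 x₀, ∀ v : Tan n x, v = ∑ i, diff n (ξ i) x v • E i x
  diff_eq : ∀ᶠ x in 𝓝 x₀, ∀ i j, diff n (ξ i) x (E j x) = if i = j then 1 else 0
  eq_chart : ∀ᶠ x in 𝓝 x₀, ∀ i, ξ i x = extChartAt (𝓡 n) x₀ x i

/-- The coordinate frame and the coordinate functions are multiplied by a bump function. -/
theorem exists_isCoordinates [T2Space M] (x₀ : M) :
    ∃ (E : Fin n → VField n M) (ξ : Fin n → M → ℝ), IsCoordinates x₀ E ξ := by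
  obtain ⟨χ⟩ : Nonempty (SmoothBumpFunction (𝓡 n) x₀) := inferInstance
  let b := (EuclideanSpace.basisFun (Fin n) ℝ).toBasis
  let e := trivializationAt (EuclideanSpace ℝ (Fin n)) (TangentSpace (𝓡 n) : M → Type _) x₀
  let E : Fin n → VField n M := fun i x => χ x • e.localFrame b i x
  let ξ : Fin n → M → ℝ := fun i x => χ x • extChartAt (𝓡 n) x₀ x i
  have hbase : e.baseSet = (chartAt (EuclideanSpace ℝ (Fin n)) x₀).source :=
    TangentBundle.trivializationAt_baseSet x₀
  have hE : ∀ i, SmoothV (E i) := fun i => by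
    refine ContMDiffOn.smul_section_of_tsupport (u := e.baseSet) χ.contMDiff.contMDiffOn
      e.open_baseSet (hbase ▸ χ.tsupport_subset_chartAt_source) ?_
    exact e.contMDiffOn_localFrame_baseSet ∞ b i
  have hξ : ∀ i, SmoothF n (ξ i) := fun i => by
    refine χ.contMDiff_smul ?_
    have h1 : ContMDiff 𝓘(ℝ, EuclideanSpace ℝ (Fin n)) 𝓘(ℝ, ℝ) ∞
        (fun v : EuclideanSpace ℝ (Fin n) => v i) :=
      (EuclideanSpace.proj i : EuclideanSpace ℝ (Fin n) →L[ℝ] ℝ).contDiff.contMDiff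
    exact h1.comp_contMDiffOn (contMDiffOn_extChartAt (I := 𝓡 n) (x := x₀))
  have hχ : ∀ᶠ x in 𝓝 x₀, χ =ᶠ[𝓝 x] 1 := eventually_eventually_nhds.2 χ.eventuallyEq_one
  have hsrc : ∀ᶠ x in 𝓝 x₀, x ∈ (chartAt (EuclideanSpace ℝ (Fin n)) x₀).source :=
    chart_source_mem_nhds _ x₀
  let S : ∀ x : M, EuclideanSpace ℝ (Fin n) →L[ℝ] Tan n x := fun x => e.symmL ℝ x
  let C : ∀ x : M, Tan n x →L[ℝ] EuclideanSpace ℝ (Fin n) := fun x => e.continuousLinearMapAt ℝ x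
  have hSC : ∀ᶠ x in 𝓝 x₀, ∀ v, S x (C x v) = v := by
    filter_upwards [hsrc] with x hx v
    exact e.symmL_continuousLinearMapAt (R := ℝ) (hbase ▸ hx) v
  have hCS : ∀ᶠ x in 𝓝 x₀, ∀ v, C x (S x v) = v := by
    filter_upwards [hsrc] with x hx v
    exact e.continuousLinearMapAt_symmL (R := ℝ) (hbase ▸ hx) v
  have hdiff : ∀ᶠ x in 𝓝 x₀, ∀ i (v : Tan n x), diff n (ξ i) x v = C x v i := by
    filter_upwards [hχ, hsrc] with x hx1 hx2 i v
    have h1 : ξ i =ᶠ[𝓝 x] (fun v : EuclideanSpace ℝ (Fin n) => v i) ∘ extChartAt (𝓡 n) x₀ := by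
      filter_upwards [hx1] with y hy
      simp [ξ, hy]
    have h2 := (mdifferentiableAt_extChartAt (I := 𝓡 n) hx2).hasMFDerivAt
    have h3 := HasMFDerivAt.comp x (EuclideanSpace.proj i :
      EuclideanSpace ℝ (Fin n) →L[ℝ] ℝ).hasFDerivAt.hasMFDerivAt h2
    have h4 := (h3.congr_of_eventuallyEq h1).mfderiv
    have h5 : C x = mfderiv (𝓡 n) 𝓘(ℝ, EuclideanSpace ℝ (Fin n)) (extChartAt (𝓡 n) x₀) x :=
      TangentBundle.continuousLinearMapAt_trivializationAt hx2
    rw [h5]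
    exact congrArg (fun L : EuclideanSpace ℝ (Fin n) →L[ℝ] ℝ => L v) h4
  have hframe : ∀ᶠ x in 𝓝 x₀, ∀ i, E i x = S x (EuclideanSpace.single i (1 : ℝ)) := by
    filter_upwards [χ.eventuallyEq_one, hsrc] with x hx1 hx2 i
    have hx : x ∈ e.baseSet := hbase ▸ hx2
    have hb : b i = EuclideanSpace.single i (1 : ℝ) := by simp [b]
    simp only [E, hx1, Pi.one_apply, one_smul, e.localFrame_apply_of_mem_baseSet b hx, ← hb]
    simp [S, Bundle.Trivialization.basisAt, hx]
  refine ⟨E, ξ, hE, hξ, ?_, ?_, ?_⟩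
  · filter_upwards [hdiff, hframe, hSC] with x h1 h2 h3 v
    conv_lhs => rw [← h3 v]
    simp only [h1, h2, ← map_smul, ← map_sum]
    congr 1
    ext k
    simp [Pi.single_apply]
  · filter_upwards [hdiff, hframe, hCS] with x h1 h2 h3 i j
    rw [h1, h2, h3]
    simp
  · filter_upwards [χ.eventuallyEq_one] with x hx i
    simp [ξ, hx]

end Chart

namespace IsCoordinates

variable {x₀ : M} {E : Fin n → VField n M} {ξ : Fin n → M → ℝ}

theorem ext {x : M} (h : ∀ v : Tan n x, v = ∑ i, diff n (ξ i) x v • E i x) {v w : Tan n x}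
    (hvw : ∀ i, diff n (ξ i) x v = diff n (ξ i) x w) : v = w := by
  rw [h v, h w]
  simp only [hvw]

variable [IsManifold (𝓡 n) ∞ M]

/-- Vector fields whose components are locally constant commute. -/
theorem lie_eq_zero {x : M} (hξ : ∀ i, SmoothF n (ξ i))
    (h : ∀ v : Tan n x, v = ∑ i, diff n (ξ i) x v • E i x) {X Y : VField n M}
    (hX : SmoothV X) (hY : SmoothV Y) (c d : Fin n → ℝ)
    (hc : ∀ᶠ y in 𝓝 x, ∀ i, dirDeriv X (ξ i) y = c i)
    (hd : ∀ᶠ y in 𝓝 x, ∀ i, dirDeriv Y (ξ i) y = d i) :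
    mlieBracket (𝓡 n) X Y x = 0 := by
  refine ext h fun i => ?_
  rw [map_zero, diff_apply, dirDeriv_lie hX hY (hξ i),
    dirDeriv_congr X (g := fun _ => d i) (hd.mono fun y hy => hy i),
    dirDeriv_congr Y (g := fun _ => c i) (hc.mono fun y hy => hy i),
    dirDeriv_const, dirDeriv_const, sub_zero]

/-- The combination of coordinate vector fields with constant coefficients. -/
theorem eventually_dirDeriv_combination (h : IsCoordinates x₀ E ξ) (c : Fin n → ℝ) :
    ∀ᶠ x in 𝓝 x₀, ∀ i, dirDeriv (fun y => ∑ j, c j • E j y) (ξ i) x = c i := by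
  filter_upwards [h.diff_eq] with x hx i
  rw [← diff_apply]
  simp [hx]

end IsCoordinates

section Extension

variable [IsManifold (𝓡 n) ∞ M] [T2Space M]

/-- Tangent vectors at a point extend to smooth vector fields which commute near that point. -/
theorem exists_commuting_extension {ι : Type*} [Finite ι] {x₀ : M} (v : ι → Tan n x₀) :
    ∃ V : ι → VField n M, (∀ k, SmoothV (V k)) ∧ (∀ k, V k x₀ = v k) ∧
      ∀ᶠ x in 𝓝 x₀, ∀ k l, mlieBracket (𝓡 n) (V k) (V l) x = 0 := by
  obtain ⟨E, ξ, h⟩ := exists_isCoordinates (n := n) x₀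
  let c : ι → Fin n → ℝ := fun k i => diff n (ξ i) x₀ (v k)
  have hV : ∀ k, SmoothV (fun y => ∑ j, c k j • E j y) := fun k =>
    smoothV_sum _ fun j _ => (h.smoothV j).smul (smoothF_const (c k j))
  refine ⟨fun k y => ∑ j, c k j • E j y, hV, fun k => (h.eq_sum.self_of_nhds (v k)).symm, ?_⟩
  have h1 := fun k => eventually_eventually_nhds.2 (h.eventually_dirDeriv_combination (c k))
  filter_upwards [h.eq_sum, eventually_all.2 h1] with x hx1 hx2 k l
  exact IsCoordinates.lie_eq_zero h.smoothF hx1 (hV k) (hV l) (c k) (c l) (hx2 k) (hx2 l)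

theorem exists_extension {x₀ : M} (v : Tan n x₀) :
    ∃ V : VField n M, SmoothV V ∧ V x₀ = v := by
  obtain ⟨V, h1, h2, -⟩ := exists_commuting_extension (fun _ : Unit => v)
  exact ⟨V (), h1 (), h2 ()⟩

/-- Forms are determined by their values on smooth vector fields. -/
theorem form_ext {p : ℕ} {x : M} {β γ : (Tan n x) [⋀^Fin p]→ₗ[ℝ] ℝ}
    (h : ∀ X : Fin p → VField n M, (∀ i, SmoothV (X i)) →
      β (fun i => X i x) = γ (fun i => X i x)) : β = γ := by
  ext v
  choose V hV hv using fun i => exists_extension (v i)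
  have := h V hV
  simpa only [hv] using this

theorem covector_ext {x : M} {β γ : Module.Dual ℝ (Tan n x)}
    (h : ∀ X : VField n M, SmoothV X → β (X x) = γ (X x)) : β = γ := by
  ext v
  obtain ⟨V, hV, rfl⟩ := exists_extension v
  exact h V hV

end Extension

/-! ### The Cartan formula for the exterior differential -/

section Cartan

theorem bracketN_id (X Y : VField n M) (x : M) :
    bracketN (fun _ => LinearMap.id) X Y x = mlieBracket (𝓡 n) X Y x := by
  simp [bracketN]

theorem cartanSum_id {q : ℕ} (α : Form n M q) (X : Fin (q + 1) → VField n M) (x : M) :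
    cartanSum (fun _ => LinearMap.id) α X x =
      ∑ j : Fin (q + 1), (-1 : ℝ) ^ (j : ℕ) *
        dirDeriv (X j) (fun y => α y (fun k => j.removeNth X k y)) x
      + bracketSum (fun _ => LinearMap.id) α X x := rfl

/-- A family of alternating forms is differentiable if its coefficients in a basis are. -/
theorem differentiableAt_of_apply_basis {F : Type*} [NormedAddCommGroup F] [NormedSpace ℝ F]
    {ι : Type*} [Fintype ι] (b : Module.Basis ι ℝ F) {q : ℕ} {η₀ : F → F [⋀^Fin q]→L[ℝ] ℝ} {t : F}
    (h : ∀ I : Fin q → ι, DifferentiableAt ℝ (fun s => η₀ s (fun k => b (I k))) t) :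
    DifferentiableAt ℝ η₀ t := by
  let L : (F [⋀^Fin q]→L[ℝ] ℝ) →ₗ[ℝ] ((Fin q → ι) → ℝ) :=
    { toFun := fun η I => η (fun k => b (I k))
      map_add' := fun _ _ => rfl
      map_smul' := fun _ _ => rfl }
  have hL : LinearMap.ker L = ⊥ := by
    refine LinearMap.ker_eq_bot.2 fun η η' hη => ?_
    refine ContinuousAlternatingMap.toAlternatingMap_injective ?_
    exact Module.Basis.ext_alternating b fun I _ => congrFun hη I
  obtain ⟨G, hG⟩ := L.exists_leftInverse_of_injective hL
  have h1 : DifferentiableAt ℝ (fun s => L (η₀ s)) t :=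
    differentiableAt_pi.2 h
  have h2 : η₀ = fun s => G (L (η₀ s)) := by
    funext s
    exact (LinearMap.congr_fun hG (η₀ s)).symm
  rw [h2]
  exact (LinearMap.toContinuousLinearMap G).differentiableAt.comp t h1

/-- The linear map `v ↦ ∑ᵢ vᵢ Eᵢ` from the model space to the tangent space at `x`. -/
def frameMap (E : Fin n → VField n M) (x : M) : EuclideanSpace ℝ (Fin n) →ₗ[ℝ] Tan n x :=
  ∑ i, (EuclideanSpace.proj i : EuclideanSpace ℝ (Fin n) →L[ℝ] ℝ).toLinearMap.smulRight (E i x)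

theorem frameMap_apply (E : Fin n → VField n M) (x : M) (v : EuclideanSpace ℝ (Fin n)) :
    frameMap E x v = ∑ i, v i • E i x := by
  simp [frameMap]

/-- A form at `x`, written in the frame `E`. -/
def formInFrame {q : ℕ} (α : Form n M q) (E : Fin n → VField n M) (x : M) :
    (EuclideanSpace ℝ (Fin n)) [⋀^Fin q]→L[ℝ] ℝ :=
  { (α x).compLinearMap (frameMap E x) with
    cont := by
      have h : ∀ v : Fin q → EuclideanSpace ℝ (Fin n), α x (fun k => frameMap E x (v k)) =
          ∑ r : Fin q → Fin n, (∏ k, v k (r k)) • α x (fun k => E (r k) x) := by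
        intro v
        simp only [frameMap_apply]
        rw [← AlternatingMap.coe_multilinearMap, MultilinearMap.map_sum]
        refine Finset.sum_congr rfl fun r _ => ?_
        rw [MultilinearMap.map_smul_univ]
      refine Continuous.congr ?_ fun v => (h v).symm
      fun_prop }

theorem formInFrame_apply {q : ℕ} (α : Form n M q) (E : Fin n → VField n M) (x : M)
    (v : Fin q → EuclideanSpace ℝ (Fin n)) :
    formInFrame α E x v = α x (fun k => frameMap E x (v k)) := rfl

theorem eventually_chart {x₀ : M} {p : M → Prop}
    (hp : ∀ᶠ x in 𝓝 x₀, p x) :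
    ∀ᶠ t in 𝓝 (extChartAt (𝓡 n) x₀ x₀), p ((extChartAt (𝓡 n) x₀).symm t) := by
  have h1 := continuousAt_extChartAt_symm (I := 𝓡 n) x₀
  rw [ContinuousAt, extChartAt_to_inv] at h1
  exact h1.eventually hp

variable [IsManifold (𝓡 n) ∞ M] {x₀ : M} {E : Fin n → VField n M} {ξ : Fin n → M → ℝ}

theorem IsCoordinates.fderiv_comp_chart_symm (h : IsCoordinates x₀ E ξ) :
    ∀ᶠ t in 𝓝 (extChartAt (𝓡 n) x₀ x₀), ∀ i v,
      fderiv ℝ (ξ i ∘ (extChartAt (𝓡 n) x₀).symm) t v = v i := by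
  have h1 := eventually_eventually_nhds.2
    ((eventually_chart h.eq_chart).and (extChartAt_target_mem_nhds (I := 𝓡 n) x₀))
  filter_upwards [h1] with t ht i v
  have h2 : ξ i ∘ (extChartAt (𝓡 n) x₀).symm =ᶠ[𝓝 t]
      (EuclideanSpace.proj i : EuclideanSpace ℝ (Fin n) →L[ℝ] ℝ) := by
    filter_upwards [ht] with s hs
    simp only [Function.comp_apply, hs.1 i, (extChartAt (𝓡 n) x₀).right_inv hs.2]
    rfl
  rw [h2.fderiv_eq, ContinuousLinearMap.fderiv]
  rfl

theorem IsCoordinates.inChart_apply (h : IsCoordinates x₀ E ξ) :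
    ∀ᶠ t in 𝓝 (extChartAt (𝓡 n) x₀ x₀), ∀ (X : VField n M) i,
      inChart x₀ X t i = dirDeriv X (ξ i) ((extChartAt (𝓡 n) x₀).symm t) := by
  filter_upwards [h.fderiv_comp_chart_symm, extChartAt_target_mem_nhds (I := 𝓡 n) x₀]
    with t h1 h2 X i
  rw [← PoissonNijenhuis.fderiv_comp_chart_symm x₀ (h.smoothF i) X h2, h1]

theorem IsCoordinates.inChart_lie (h : IsCoordinates x₀ E ξ) (X Y : VField n M) :
    inChart x₀ (mlieBracket (𝓡 n) X Y) (extChartAt (𝓡 n) x₀ x₀) =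
      lieBracket ℝ (inChart x₀ X) (inChart x₀ Y) (extChartAt (𝓡 n) x₀ x₀) := by
  ext i
  rw [h.inChart_apply.self_of_nhds, extChartAt_to_inv, dirDeriv_lie_chart X Y (h.smoothF i),
    h.fderiv_comp_chart_symm.self_of_nhds]

theorem IsCoordinates.formInFrame_inChart (h : IsCoordinates x₀ E ξ) {q : ℕ} (α : Form n M q) :
    ∀ᶠ t in 𝓝 (extChartAt (𝓡 n) x₀ x₀), ∀ X : Fin q → VField n M,
      formInFrame α E ((extChartAt (𝓡 n) x₀).symm t) (fun k => inChart x₀ (X k) t) =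
        α ((extChartAt (𝓡 n) x₀).symm t) (fun k => X k ((extChartAt (𝓡 n) x₀).symm t)) := by
  filter_upwards [h.inChart_apply, eventually_chart h.eq_sum] with t h1 h2 X
  rw [formInFrame_apply]
  congr 1
  funext k
  rw [frameMap_apply]
  conv_rhs => rw [h2 (X k _)]
  simp only [h1, diff_apply]

theorem IsCoordinates.inChart_frame (h : IsCoordinates x₀ E ξ) :
    ∀ᶠ t in 𝓝 (extChartAt (𝓡 n) x₀ x₀), ∀ i,
      inChart x₀ (E i) t = EuclideanSpace.basisFun (Fin n) ℝ i := by
  filter_upwards [h.inChart_apply, eventually_chart h.diff_eq] with t h1 h2 i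
  ext k
  rw [h1, ← diff_apply, h2]
  simp

theorem IsCoordinates.differentiableAt_formInFrame (h : IsCoordinates x₀ E ξ) {q : ℕ}
    {α : Form n M q} (hα : SmoothForm α) :
    DifferentiableAt ℝ (fun t => formInFrame α E ((extChartAt (𝓡 n) x₀).symm t))
      (extChartAt (𝓡 n) x₀ x₀) := by
  refine differentiableAt_of_apply_basis (EuclideanSpace.basisFun (Fin n) ℝ).toBasis fun I => ?_
  have h1 := (contDiffAt_comp_chart_symm x₀
    (hα (fun k => E (I k)) fun k => h.smoothV (I k))).differentiableAt (by simp)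
  refine h1.congr_of_eventuallyEq ?_
  filter_upwards [h.formInFrame_inChart α, h.inChart_frame] with t h2 h3
  have h4 := h2 (fun k => E (I k))
  simp only [h3] at h4
  simp only [OrthonormalBasis.coe_toBasis]
  exact h4

/-- The exterior derivative in coordinates satisfies the Cartan formula. -/
theorem exists_eq_cartanSum_id [T2Space M] {q : ℕ} {α : Form n M q} (hα : SmoothForm α) (x₀ : M) :
    ∃ β : (Tan n x₀) [⋀^Fin (q + 1)]→ₗ[ℝ] ℝ,
      ∀ X : Fin (q + 1) → VField n M, (∀ i, SmoothV (X i)) →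
        β (fun i => X i x₀) = cartanSum (fun _ => LinearMap.id) α X x₀ := by
  obtain ⟨E, ξ, h⟩ := exists_isCoordinates (n := n) x₀
  let A : EuclideanSpace ℝ (Fin n) → EuclideanSpace ℝ (Fin n) [⋀^Fin q]→L[ℝ] ℝ :=
    fun t => formInFrame α E ((extChartAt (𝓡 n) x₀).symm t)
  let L : Tan n x₀ →ₗ[ℝ] EuclideanSpace ℝ (Fin n) :=
    (WithLp.linearEquiv 2 ℝ (Fin n → ℝ)).symm.toLinearMap ∘ₗ
      LinearMap.pi (fun i => diff n (ξ i) x₀)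
  have hL : ∀ X : VField n M, L (X x₀) = inChart x₀ X (extChartAt (𝓡 n) x₀ x₀) := by
    intro X
    ext i
    rw [h.inChart_apply.self_of_nhds, extChartAt_to_inv, ← diff_apply]
    rfl
  have hA : DifferentiableAt ℝ A (extChartAt (𝓡 n) x₀ x₀) := h.differentiableAt_formInFrame hα
  have hval : ∀ Z : Fin q → VField n M,
      A (extChartAt (𝓡 n) x₀ x₀) (fun k => inChart x₀ (Z k) (extChartAt (𝓡 n) x₀ x₀)) =
        α x₀ (fun k => Z k x₀) := by
    intro Z
    refine ((h.formInFrame_inChart α).self_of_nhds Z).trans ?_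
    exact congrArg (fun y => α y (fun k => Z k y)) (extChartAt_to_inv (I := 𝓡 n) x₀)
  -- `A` is the coordinate expression of `α`, and `L` sends a tangent vector to its components.
  refine ⟨(extDeriv A (extChartAt (𝓡 n) x₀ x₀)).toAlternatingMap.compLinearMap L, fun X hX => ?_⟩
  have hX' := fun i => differentiableAt_inChart x₀ (hX i)
  have h0 : (extDeriv A (extChartAt (𝓡 n) x₀ x₀)).toAlternatingMap.compLinearMap L
      (fun i => X i x₀) = extDeriv A (extChartAt (𝓡 n) x₀ x₀)
        (fun i => inChart x₀ (X i) (extChartAt (𝓡 n) x₀ x₀)) := by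
    simp only [← hL]; rfl
  have hder : ∀ j : Fin (q + 1),
      fderiv ℝ (fun t => A t (j.removeNth fun i => inChart x₀ (X i) t)) (extChartAt (𝓡 n) x₀ x₀)
        (inChart x₀ (X j) (extChartAt (𝓡 n) x₀ x₀)) =
      dirDeriv (X j) (fun y => α y (fun k => j.removeNth X k y)) x₀ := by
    intro j
    have h1 : (fun t => A t (j.removeNth fun i => inChart x₀ (X i) t)) =ᶠ[𝓝 (extChartAt (𝓡 n) x₀ x₀)]
        (fun y => α y (fun k => j.removeNth X k y)) ∘ (extChartAt (𝓡 n) x₀).symm := by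
      filter_upwards [h.formInFrame_inChart α] with t ht
      exact ht (j.removeNth X)
    rw [h1.fderiv_eq, fderiv_comp_chart_symm x₀
      (hα (fun k => j.removeNth X k) fun k => hX _) (X j) (mem_extChartAt_target (I := 𝓡 n) x₀),
      extChartAt_to_inv]
  rw [h0, cartanSum_id]
  cases q with
  | zero =>
    rw [extDeriv_apply_vectorField_of_pairwise_commute hA hX'
      (fun i j hij => absurd (Fin.subsingleton_one.elim i j) hij)]
    simp only [hder, bracketSum, zsmul_eq_mul, Int.cast_pow, Int.cast_neg, Int.cast_one, add_zero]
  | succ r =>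
    rw [extDeriv_apply_vectorField hA hX']
    simp only [hder, zsmul_eq_mul, Int.cast_pow, Int.cast_neg, Int.cast_one, sub_eq_add_neg,
      bracketSum]
    congr 1
    rw [← Finset.sum_neg_distrib]
    refine Finset.sum_congr rfl fun i _ => ?_
    rw [← Finset.sum_neg_distrib]
    refine Finset.sum_congr rfl fun j _ => ?_
    rw [← h.inChart_lie, bracketN_id]
    have h1 := hval (Matrix.vecCons (mlieBracket (𝓡 n) (X i.castSucc) (X j.succ))
      (j.removeNth (i.castSucc.removeNth X)))
    have h2 : ∀ t, (fun k => inChart x₀ (Matrix.vecCons (mlieBracket (𝓡 n) (X i.castSucc) (X j.succ))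
        (j.removeNth (i.castSucc.removeNth X)) k) t) =
        Matrix.vecCons (inChart x₀ (mlieBracket (𝓡 n) (X i.castSucc) (X j.succ)) t)
          (j.removeNth (i.castSucc.removeNth fun k => inChart x₀ (X k) t)) := by
      intro t
      funext k
      refine Fin.cases rfl (fun _ => rfl) k
    have h3 : (fun k => (Matrix.vecCons (mlieBracket (𝓡 n) (X i.castSucc) (X j.succ))
        (j.removeNth (i.castSucc.removeNth X)) : Fin (r + 1) → VField n M) k x₀) =
        Matrix.vecCons (mlieBracket (𝓡 n) (X i.castSucc) (X j.succ) x₀)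
          (j.removeNth (i.castSucc.removeNth fun k => X k x₀)) := by
      funext k
      refine Fin.cases rfl (fun _ => rfl) k
    rw [h2, h3] at h1
    rw [h1, ← add_assoc, pow_succ]
    ring

/-- The Cartan formula: the defining condition of `extd α` is satisfiable, so that `extd α` is not
the default value. -/
theorem extd_apply [T2Space M] {q : ℕ} {α : Form n M q} (hα : SmoothForm α)
    (X : Fin (q + 1) → VField n M) (hX : ∀ i, SmoothV (X i)) (x : M) :
    extd α x (fun i => X i x) = cartanSum (fun _ => LinearMap.id) α X x := by
  have h := exists_eq_cartanSum_id hα x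
  rw [extd, dN, dif_pos h]
  exact h.choose_spec X hX

end Cartan

/-! ### Forms of low degree evaluated on vector fields -/

section Evaluation

/-- The vector field `N X`. -/
def act (N : Endo n M) (X : VField n M) : VField n M := fun x => N x (X x)

theorem act_apply (N : Endo n M) (X : VField n M) (x : M) : act N X x = N x (X x) := rfl

theorem act_id (X : VField n M) : act (fun _ => LinearMap.id) X = X := rfl

theorem bracketN_apply (N : Endo n M) (X Y : VField n M) (x : M) :
    bracketN N X Y x = mlieBracket (𝓡 n) (act N X) Y x + mlieBracket (𝓡 n) X (act N Y) x
      - N x (mlieBracket (𝓡 n) X Y x) := rfl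

theorem torsion_apply (N : Endo n M) (X Y : VField n M) (x : M) :
    torsion N X Y x = mlieBracket (𝓡 n) (act N X) (act N Y) x
      - N x (mlieBracket (𝓡 n) (act N X) Y x + mlieBracket (𝓡 n) X (act N Y) x
        - N x (mlieBracket (𝓡 n) X Y x)) := rfl

/-- The function `Ω(X, Y)`. -/
def eval₂ (Ω : Form n M 2) (X Y : VField n M) : M → ℝ := fun x => Ω x ![X x, Y x]

/-- The function `φ(X, Y, Z)`. -/
def eval₃ (φ : Form n M 3) (X Y Z : VField n M) : M → ℝ := fun x => φ x ![X x, Y x, Z x]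

theorem vec₂_apply (X Y : VField n M) (x : M) :
    (fun i => (![X, Y] : Fin 2 → VField n M) i x) = ![X x, Y x] := by
  funext i; fin_cases i <;> rfl

theorem vec₃_apply (X Y Z : VField n M) (x : M) :
    (fun i => (![X, Y, Z] : Fin 3 → VField n M) i x) = ![X x, Y x, Z x] := by
  funext i; fin_cases i <;> rfl

theorem form₂_swap {V : Type*} [AddCommGroup V] [Module ℝ V] (η : V [⋀^Fin 2]→ₗ[ℝ] ℝ) (u v : V) :
    η ![u, v] = -η ![v, u] := by
  have h := η.map_swap ![v, u] (i := 0) (j := 1) (by decide)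
  rw [← h]
  congr 1
  funext i; fin_cases i <;> rfl

theorem form₂_add_left {V : Type*} [AddCommGroup V] [Module ℝ V] (η : V [⋀^Fin 2]→ₗ[ℝ] ℝ)
    (u u' v : V) : η ![u + u', v] = η ![u, v] + η ![u', v] :=
  η.toMultilinearMap.cons_add ![v] u u'

theorem form₂_smul_left {V : Type*} [AddCommGroup V] [Module ℝ V] (η : V [⋀^Fin 2]→ₗ[ℝ] ℝ)
    (c : ℝ) (u v : V) : η ![c • u, v] = c * η ![u, v] :=
  η.toMultilinearMap.cons_smul ![v] c u

theorem form₂_neg_left {V : Type*} [AddCommGroup V] [Module ℝ V] (η : V [⋀^Fin 2]→ₗ[ℝ] ℝ)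
    (u v : V) : η ![-u, v] = -η ![u, v] := by
  rw [← neg_one_smul ℝ u, form₂_smul_left]; ring

theorem form₂_sub_left {V : Type*} [AddCommGroup V] [Module ℝ V] (η : V [⋀^Fin 2]→ₗ[ℝ] ℝ)
    (u u' v : V) : η ![u - u', v] = η ![u, v] - η ![u', v] := by
  rw [sub_eq_add_neg, form₂_add_left, form₂_neg_left]; ring

theorem eval₂_swap (Ω : Form n M 2) (X Y : VField n M) (x : M) :
    eval₂ Ω X Y x = -eval₂ Ω Y X x := form₂_swap _ _ _

theorem eval₂_swap_fun (Ω : Form n M 2) (X Y : VField n M) :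
    eval₂ Ω X Y = fun x => -eval₂ Ω Y X x := funext fun x => eval₂_swap Ω X Y x

theorem insertEndo_apply {p : ℕ} (N : Endo n M) (η : Form n M p) (x : M) (v : Fin p → Tan n x) :
    insertEndo N η x v = ∑ i, η x (Function.update v i (N x (v i))) := by
  have h : insertEndo N η x v =
      ∑ i : Fin p, η x (fun j => (if j = i then N x else LinearMap.id) (v j)) := by
    change (∑ i : Fin p, (η x).toMultilinearMap.compLinearMap
      (fun j => if j = i then N x else LinearMap.id)) v = _
    simp
  rw [h]
  refine Finset.sum_congr rfl fun i _ => congrArg (η x) (funext fun j => ?_)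
  by_cases hj : j = i
  · subst hj; simp
  · simp [hj]

theorem insertEndo_add_left {p : ℕ} (N K : Endo n M) (η : Form n M p) :
    insertEndo (fun x => N x + K x) η = insertEndo N η + insertEndo K η := by
  funext x
  ext v
  rw [Pi.add_apply, AlternatingMap.add_apply, insertEndo_apply, insertEndo_apply,
    insertEndo_apply, ← Finset.sum_add_distrib]
  exact Finset.sum_congr rfl fun i _ => (η x).map_update_add v i _ _

theorem insertEndo_add_right {p : ℕ} (N : Endo n M) (η ζ : Form n M p) :
    insertEndo N (η + ζ) = insertEndo N η + insertEndo N ζ := by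
  funext x
  ext v
  rw [Pi.add_apply, AlternatingMap.add_apply, insertEndo_apply, insertEndo_apply,
    insertEndo_apply, ← Finset.sum_add_distrib]
  rfl

theorem insertEndo_smul_right {p : ℕ} (N : Endo n M) (c : ℝ) (η : Form n M p) :
    insertEndo N (c • η) = c • insertEndo N η := by
  funext x
  ext v
  rw [Pi.smul_apply, AlternatingMap.smul_apply, insertEndo_apply, insertEndo_apply,
    Finset.smul_sum]
  rfl

theorem insertEndo_zero_right {p : ℕ} (N : Endo n M) : insertEndo N (0 : Form n M p) = 0 := by
  funext x
  ext v
  rw [insertEndo_apply]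
  exact Finset.sum_eq_zero fun _ _ => rfl

theorem insertEndo_apply₂ (N : Endo n M) (Ω : Form n M 2) (x : M) (u v : Tan n x) :
    insertEndo N Ω x ![u, v] = Ω x ![N x u, v] + Ω x ![u, N x v] := by
  rw [insertEndo_apply, Fin.sum_univ_two]
  congr 2 <;> (funext i; fin_cases i <;> rfl)

theorem insertEndo_apply₃ (N : Endo n M) (φ : Form n M 3) (x : M) (u v w : Tan n x) :
    insertEndo N φ x ![u, v, w] =
      φ x ![N x u, v, w] + φ x ![u, N x v, w] + φ x ![u, v, N x w] := by
  rw [insertEndo_apply, Fin.sum_univ_three]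
  refine congrArg₂ (· + ·) (congrArg₂ (· + ·) ?_ ?_) ?_ <;>
    (refine congrArg (φ x) ?_; funext i; fin_cases i <;> rfl)

theorem eval₂_insertEndo (N : Endo n M) (Ω : Form n M 2) (X Y : VField n M) :
    eval₂ (insertEndo N Ω) X Y = fun x => eval₂ Ω (act N X) Y x + eval₂ Ω X (act N Y) x :=
  funext fun x => insertEndo_apply₂ N Ω x (X x) (Y x)

theorem eval₃_insertEndo (N : Endo n M) (φ : Form n M 3) (X Y Z : VField n M) :
    eval₃ (insertEndo N φ) X Y Z = fun x =>
      eval₃ φ (act N X) Y Z x + eval₃ φ X (act N Y) Z x + eval₃ φ X Y (act N Z) x :=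
  funext fun x => insertEndo_apply₃ N φ x (X x) (Y x) (Z x)

/-- The right-hand side of the Cartan formula for `d_N Ω (X, Y, Z)`, for a 2-form `Ω`. -/
def cartan₂ (N : Endo n M) (Ω : Form n M 2) (X Y Z : VField n M) (x : M) : ℝ :=
  dirDeriv (act N X) (eval₂ Ω Y Z) x - dirDeriv (act N Y) (eval₂ Ω X Z) x
    + dirDeriv (act N Z) (eval₂ Ω X Y) x
    - Ω x ![bracketN N X Y x, Z x] + Ω x ![bracketN N X Z x, Y x] - Ω x ![bracketN N Y Z x, X x]

theorem cartanSum_two (N : Endo n M) (Ω : Form n M 2) (X : Fin 3 → VField n M) (x : M) :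
    cartanSum N Ω X x = cartan₂ N Ω (X 0) (X 1) (X 2) x := by
  have h0 : (fun y => Ω y ((0 : Fin 3).removeNth fun k => X k y)) = eval₂ Ω (X 1) (X 2) := by
    funext y; refine congrArg (Ω y) ?_; funext i; fin_cases i <;> rfl
  have h1 : (fun y => Ω y ((1 : Fin 3).removeNth fun k => X k y)) = eval₂ Ω (X 0) (X 2) := by
    funext y; refine congrArg (Ω y) ?_; funext i; fin_cases i <;> rfl
  have h2 : (fun y => Ω y ((2 : Fin 3).removeNth fun k => X k y)) = eval₂ Ω (X 0) (X 1) := by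
    funext y; refine congrArg (Ω y) ?_; funext i; fin_cases i <;> rfl
  have hb : bracketSum N Ω X x = - Ω x ![bracketN N (X 0) (X 1) x, X 2 x]
      + Ω x ![bracketN N (X 0) (X 2) x, X 1 x] - Ω x ![bracketN N (X 1) (X 2) x, X 0 x] := by
    have e00 : (Matrix.vecCons (bracketN N (X 0) (X 1) x)
        ((0 : Fin 2).removeNth ((0 : Fin 3).removeNth fun k => X k x))) =
        ![bracketN N (X 0) (X 1) x, X 2 x] := by funext i; fin_cases i <;> rfl
    have e01 : (Matrix.vecCons (bracketN N (X 0) (X 2) x)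
        ((1 : Fin 2).removeNth ((0 : Fin 3).removeNth fun k => X k x))) =
        ![bracketN N (X 0) (X 2) x, X 1 x] := by funext i; fin_cases i <;> rfl
    have e11 : (Matrix.vecCons (bracketN N (X 1) (X 2) x)
        ((1 : Fin 2).removeNth ((1 : Fin 3).removeNth fun k => X k x))) =
        ![bracketN N (X 1) (X 2) x, X 0 x] := by funext i; fin_cases i <;> rfl
    have i0 : (Finset.Ici (0 : Fin 2)) = {0, 1} := by decide
    have i1 : (Finset.Ici (1 : Fin 2)) = {1} := by decide
    simp only [bracketSum]
    rw [Fin.sum_univ_two, i0, i1, Finset.sum_pair (by decide), Finset.sum_singleton]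
    change (-1 : ℝ) ^ (0 + (0 + 1)) * Ω x (Matrix.vecCons (bracketN N (X 0) (X 1) x)
        ((0 : Fin 2).removeNth ((0 : Fin 3).removeNth fun k => X k x))) +
      (-1 : ℝ) ^ (0 + (1 + 1)) * Ω x (Matrix.vecCons (bracketN N (X 0) (X 2) x)
        ((1 : Fin 2).removeNth ((0 : Fin 3).removeNth fun k => X k x))) +
      (-1 : ℝ) ^ (1 + (1 + 1)) * Ω x (Matrix.vecCons (bracketN N (X 1) (X 2) x)
        ((1 : Fin 2).removeNth ((1 : Fin 3).removeNth fun k => X k x))) = _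
    rw [e00, e01, e11]
    ring
  rw [cartanSum, hb, Fin.sum_univ_three, h0, h1, h2, cartan₂]
  simp only [Fin.val_zero, Fin.val_one, Fin.val_two]
  change (-1 : ℝ) ^ 0 * dirDeriv (act N (X 0)) _ x + (-1 : ℝ) ^ 1 * dirDeriv (act N (X 1)) _ x +
    (-1 : ℝ) ^ 2 * dirDeriv (act N (X 2)) _ x + _ = _
  ring

end Evaluation

/-! ### The differentials `d` and `d_N` -/

section Differential

variable [IsManifold (𝓡 n) ∞ M]

theorem SmoothEndo.act {N : Endo n M} (hN : SmoothEndo N) {X : VField n M} (hX : SmoothV X) :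
    SmoothV (act N X) := hN X hX

theorem smoothEndo_id : SmoothEndo (fun _ => LinearMap.id : Endo n M) := fun _ hX => hX

theorem SmoothEndo.add {N K : Endo n M} (hN : SmoothEndo N) (hK : SmoothEndo K) :
    SmoothEndo (fun x => N x + K x) := fun X hX => (hN X hX).add (hK X hX)

theorem SmoothForm.eval₂ {Ω : Form n M 2} (hΩ : SmoothForm Ω) {X Y : VField n M} (hX : SmoothV X)
    (hY : SmoothV Y) : SmoothF n (eval₂ Ω X Y) := by
  have h := hΩ ![X, Y] (by intro i; fin_cases i <;> assumption)
  simp only [vec₂_apply] at h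
  exact h

theorem SmoothForm.add {p : ℕ} {α β : Form n M p} (hα : SmoothForm α) (hβ : SmoothForm β) :
    SmoothForm (α + β) := fun X hX => (hα X hX).add (hβ X hX)

theorem SmoothForm.smul {p : ℕ} (c : ℝ) {α : Form n M p} (hα : SmoothForm α) :
    SmoothForm (c • α) := fun X hX => (smoothF_const c).mul (hα X hX)

theorem smoothForm_of_eval₂ {Ω : Form n M 2}
    (h : ∀ X Y : VField n M, SmoothV X → SmoothV Y → SmoothF n (PoissonNijenhuis.eval₂ Ω X Y)) :
    SmoothForm Ω := by
  intro X hX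
  have h1 := h (X 0) (X 1) (hX 0) (hX 1)
  have h2 : (fun x => Ω x (fun i => X i x)) = PoissonNijenhuis.eval₂ Ω (X 0) (X 1) := by
    funext x; refine congrArg (Ω x) ?_; funext i; fin_cases i <;> rfl
  rwa [h2]

theorem SmoothForm.insertEndo {Ω : Form n M 2} (hΩ : SmoothForm Ω) {N : Endo n M}
    (hN : SmoothEndo N) : SmoothForm (insertEndo N Ω) := by
  refine smoothForm_of_eval₂ fun X Y hX hY => ?_
  rw [eval₂_insertEndo]
  exact (hΩ.eval₂ (hN.act hX) hY).add (hΩ.eval₂ hX (hN.act hY))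

theorem SmoothEndo.bracketN {N : Endo n M} (hN : SmoothEndo N) {X Y : VField n M}
    (hX : SmoothV X) (hY : SmoothV Y) : SmoothV (bracketN N X Y) :=
  (((hN X hX).lie hY).add (hX.lie (hN Y hY))).sub (hN _ (hX.lie hY))

theorem smoothF_cartanSum {q : ℕ} {N : Endo n M} (hN : SmoothEndo N) {α : Form n M q}
    (hα : SmoothForm α) {X : Fin (q + 1) → VField n M} (hX : ∀ i, SmoothV (X i)) :
    SmoothF n (cartanSum N α X) := by
  refine SmoothF.add (smoothF_sum _ fun j _ => (smoothF_const _).mul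
    ((hN _ (hX j)).dirDeriv (hα (fun k => j.removeNth X k) fun k => hX _))) ?_
  cases q with
  | zero => exact smoothF_const 0
  | succ r =>
    refine smoothF_sum _ fun i _ => smoothF_sum _ fun j _ => (smoothF_const _).mul ?_
    have h := hα (Matrix.vecCons (PoissonNijenhuis.bracketN N (X i.castSucc) (X j.succ))
      (j.removeNth (i.castSucc.removeNth X))) (by
        intro k
        refine Fin.cases ?_ (fun k => ?_) k
        · exact hN.bracketN (hX _) (hX _)
        · exact hX _)
    convert h using 3 with x
    funext k
    refine Fin.cases rfl (fun _ => rfl) k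

theorem cartanSum_add {q : ℕ} (N : Endo n M) {α β : Form n M q}
    (hα : SmoothForm α) (hβ : SmoothForm β) {X : Fin (q + 1) → VField n M}
    (hX : ∀ i, SmoothV (X i)) (x : M) :
    cartanSum N (α + β) X x = cartanSum N α X x + cartanSum N β X x := by
  have h1 : bracketSum N (α + β) X x = bracketSum N α X x + bracketSum N β X x := by
    cases q with
    | zero => exact (add_zero (0 : ℝ)).symm
    | succ r => simp [bracketSum, mul_add, Finset.sum_add_distrib]
  have h2 : ∀ j : Fin (q + 1), dirDeriv (fun y => N y (X j y))
      (fun y => (α + β) y (j.removeNth (fun k => X k y))) x =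
      dirDeriv (fun y => N y (X j y)) (fun y => α y (j.removeNth (fun k => X k y))) x +
      dirDeriv (fun y => N y (X j y)) (fun y => β y (j.removeNth (fun k => X k y))) x := fun j =>
    dirDeriv_add _ (hα (fun k => j.removeNth X k) fun k => hX _)
      (hβ (fun k => j.removeNth X k) fun k => hX _) x
  simp only [cartanSum, h1, h2, mul_add, Finset.sum_add_distrib]
  ring

theorem cartanSum_smul {q : ℕ} (N : Endo n M) (c : ℝ) {α : Form n M q}
    (hα : SmoothForm α) {X : Fin (q + 1) → VField n M}
    (hX : ∀ i, SmoothV (X i)) (x : M) :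
    cartanSum N (c • α) X x = c * cartanSum N α X x := by
  have h1 : bracketSum N (c • α) X x = c * bracketSum N α X x := by
    cases q with
    | zero => exact (mul_zero c).symm
    | succ r =>
      simp only [bracketSum, Pi.smul_apply, AlternatingMap.smul_apply, smul_eq_mul, Finset.mul_sum]
      exact Finset.sum_congr rfl fun i _ => Finset.sum_congr rfl fun j _ => by ring
  have h2 : ∀ j : Fin (q + 1), dirDeriv (fun y => N y (X j y))
      (fun y => (c • α) y (j.removeNth (fun k => X k y))) x =
      c * dirDeriv (fun y => N y (X j y)) (fun y => α y (j.removeNth (fun k => X k y))) x :=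
    fun j => dirDeriv_const_mul _ c (hα (fun k => j.removeNth X k) fun k => hX _) x
  simp only [cartanSum, h1, h2, mul_add, Finset.mul_sum]
  congr 1
  exact Finset.sum_congr rfl fun j _ => by ring

theorem dirDeriv_comm {X Y : VField n M} (hX : SmoothV X) (hY : SmoothV Y) {f : M → ℝ}
    (hf : SmoothF n f) {x : M} (h : mlieBracket (𝓡 n) X Y x = 0) :
    dirDeriv X (dirDeriv Y f) x = dirDeriv Y (dirDeriv X f) x := by
  have h1 := dirDeriv_lie hX hY hf x
  rw [← diff_apply, h, map_zero] at h1
  linarith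

variable [T2Space M]

theorem SmoothForm.extd {q : ℕ} {α : Form n M q} (hα : SmoothForm α) :
    SmoothForm (extd α) := by
  intro X hX
  have h : (fun x => PoissonNijenhuis.extd α x (fun i => X i x)) =
      cartanSum (fun _ => LinearMap.id) α X := funext fun x => extd_apply hα X hX x
  rw [h]
  exact smoothF_cartanSum smoothEndo_id hα hX

theorem extd_add {q : ℕ} {α β : Form n M q} (hα : SmoothForm α) (hβ : SmoothForm β) :
    extd (α + β) = extd α + extd β := by
  funext x
  refine form_ext fun X hX => ?_
  rw [extd_apply (hα.add hβ) X hX, Pi.add_apply, AlternatingMap.add_apply, extd_apply hα X hX,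
    extd_apply hβ X hX, cartanSum_add _ hα hβ hX]

theorem extd_smul {q : ℕ} (c : ℝ) {α : Form n M q} (hα : SmoothForm α) :
    extd (c • α) = c • extd α := by
  funext x
  refine form_ext fun X hX => ?_
  rw [extd_apply (hα.smul c) X hX, Pi.smul_apply, AlternatingMap.smul_apply, extd_apply hα X hX,
    cartanSum_smul _ c hα hX, smul_eq_mul]

theorem eval₃_extd {Ω : Form n M 2} (hΩ : SmoothForm Ω) {X Y Z : VField n M} (hX : SmoothV X)
    (hY : SmoothV Y) (hZ : SmoothV Z) (x : M) :
    eval₃ (extd Ω) X Y Z x = cartan₂ (fun _ => LinearMap.id) Ω X Y Z x := by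
  have h := extd_apply hΩ ![X, Y, Z] (by intro i; fin_cases i <;> assumption) x
  rw [vec₃_apply, cartanSum_two] at h
  exact h

/-- On vector fields which commute at a point, the terms with brackets drop out of the Cartan
formula. -/
theorem extd_apply_of_commute {q : ℕ} {α : Form n M q} (hα : SmoothForm α)
    {V : Fin (q + 1) → VField n M} (hV : ∀ i, SmoothV (V i)) {x : M}
    (hc : ∀ k l, mlieBracket (𝓡 n) (V k) (V l) x = 0) :
    extd α x (fun i => V i x) = ∑ j : Fin (q + 1), (-1 : ℝ) ^ (j : ℕ) *
        dirDeriv (V j) (fun y => α y (fun k => j.removeNth V k y)) x := by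
  rw [extd_apply hα V hV, cartanSum_id, add_eq_left]
  cases q with
  | zero => rfl
  | succ r =>
    simp only [bracketSum, bracketN_id, hc]
    refine Finset.sum_eq_zero fun i _ => Finset.sum_eq_zero fun j _ => ?_
    rw [(α x).map_coord_zero 0 rfl, mul_zero]

/-- The identity `d_N = i_N ∘ d - d ∘ i_N` on 2-forms, in terms of the Cartan formulas. -/
theorem cartan₂_eq {N : Endo n M} (hN : SmoothEndo N) {Ω : Form n M 2} (hΩ : SmoothForm Ω)
    {X Y Z : VField n M} (hX : SmoothV X) (hY : SmoothV Y) (hZ : SmoothV Z) (x : M) :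
    cartan₂ N Ω X Y Z x =
      eval₃ (insertEndo N (extd Ω)) X Y Z x - eval₃ (extd (insertEndo N Ω)) X Y Z x := by
  have hNX := hN.act hX
  have hNY := hN.act hY
  have hNZ := hN.act hZ
  rw [eval₃_insertEndo, eval₃_extd (hΩ.insertEndo hN) hX hY hZ]
  simp only [eval₃_extd hΩ hNX hY hZ, eval₃_extd hΩ hX hNY hZ, eval₃_extd hΩ hX hY hNZ]
  simp only [cartan₂, eval₂_insertEndo, bracketN_id, insertEndo_apply₂]
  rw [dirDeriv_add _ (hΩ.eval₂ hNY hZ) (hΩ.eval₂ hY hNZ),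
    dirDeriv_add _ (hΩ.eval₂ hNX hZ) (hΩ.eval₂ hX hNZ),
    dirDeriv_add _ (hΩ.eval₂ hNX hY) (hΩ.eval₂ hX hNY)]
  simp only [bracketN_apply, form₂_sub_left, form₂_add_left, act_apply, act_id]
  ring

theorem dN_eq {N : Endo n M} (hN : SmoothEndo N) {Ω : Form n M 2} (hΩ : SmoothForm Ω) :
    dN N Ω = insertEndo N (extd Ω) - extd (insertEndo N Ω) := by
  funext x
  have h : ∃ β : (Tan n x) [⋀^Fin (2 + 1)]→ₗ[ℝ] ℝ,
      ∀ X : Fin (2 + 1) → VField n M, (∀ i, SmoothV (X i)) →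
        β (fun i => X i x) = cartanSum N Ω X x := by
    refine ⟨insertEndo N (extd Ω) x - extd (insertEndo N Ω) x, fun X hX => ?_⟩
    rw [cartanSum_two, cartan₂_eq hN hΩ (hX 0) (hX 1) (hX 2), AlternatingMap.sub_apply]
    have h1 : (fun i => X i x) = ![X 0 x, X 1 x, X 2 x] := by
      funext i; fin_cases i <;> rfl
    rw [h1]; rfl
  refine form_ext fun X hX => ?_
  rw [dN, dif_pos h, h.choose_spec X hX]
  rw [cartanSum_two, cartan₂_eq hN hΩ (hX 0) (hX 1) (hX 2), Pi.sub_apply, AlternatingMap.sub_apply]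
  have h1 : (fun i => X i x) = ![X 0 x, X 1 x, X 2 x] := by
    funext i; fin_cases i <;> rfl
  rw [h1]; rfl

theorem dN_eq_neg {N : Endo n M} (hN : SmoothEndo N) {Ω : Form n M 2} (hΩ : SmoothForm Ω)
    (hd : extd Ω = 0) : dN N Ω = -extd (insertEndo N Ω) := by
  rw [dN_eq hN hΩ, hd, insertEndo_zero_right, zero_sub]

/-- `d (d Ω) = 0` for a 2-form `Ω`. -/
theorem extd_extd {Ω : Form n M 2} (hΩ : SmoothForm Ω) : extd (extd Ω) = 0 := by
  funext x
  ext v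
  obtain ⟨V, hV, hv, hc⟩ := exists_commuting_extension v
  have h0 : v = fun i => V i x := funext fun i => (hv i).symm
  rw [h0, extd_apply_of_commute hΩ.extd hV hc.self_of_nhds]
  have h1 : ∀ j : Fin 4, dirDeriv (V j) (fun y => extd Ω y (fun k => j.removeNth V k y)) x =
      ∑ k : Fin 3, (-1 : ℝ) ^ (k : ℕ) * dirDeriv (V j) (dirDeriv (j.removeNth V k)
        (fun y => Ω y (fun l => k.removeNth (j.removeNth V) l y))) x := by
    intro j
    have h2 : (fun y => extd Ω y (fun k => j.removeNth V k y)) =ᶠ[𝓝 x] fun y =>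
        ∑ k : Fin 3, (-1 : ℝ) ^ (k : ℕ) * dirDeriv (j.removeNth V k)
        (fun y => Ω y (fun l => k.removeNth (j.removeNth V) l y)) y := by
      filter_upwards [hc] with y hy
      exact extd_apply_of_commute hΩ (fun i => hV _) (fun k l => hy _ _)
    have h3 : ∀ k : Fin 3, SmoothF n (dirDeriv (j.removeNth V k)
        (fun y => Ω y (fun l => k.removeNth (j.removeNth V) l y))) := fun k =>
      SmoothV.dirDeriv (hV _) (hΩ (fun l => k.removeNth (j.removeNth V) l) fun l => hV _)
    rw [dirDeriv_congr _ h2, dirDeriv_sum _ _ fun k _ => (smoothF_const _).mul (h3 k)]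
    exact Finset.sum_congr rfl fun k _ => dirDeriv_const_mul _ _ (h3 k) x
  have e : ∀ (j : Fin 4) (k : Fin 3), (fun y => Ω y (fun l => k.removeNth (j.removeNth V) l y)) =
      eval₂ Ω (k.removeNth (j.removeNth V) 0) (k.removeNth (j.removeNth V) 1) := by
    intro j k
    funext y
    refine congrArg (Ω y) ?_
    funext i; fin_cases i <;> rfl
  have hcomm : ∀ i j k l, dirDeriv (V i) (dirDeriv (V j) (eval₂ Ω (V k) (V l))) x =
      dirDeriv (V j) (dirDeriv (V i) (eval₂ Ω (V k) (V l))) x := fun i j k l =>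
    dirDeriv_comm (hV i) (hV j) (hΩ.eval₂ (hV k) (hV l)) (hc.self_of_nhds i j)
  simp only [h1, e, Fin.sum_univ_three]
  refine (Fin.sum_univ_four _).trans ?_
  change (-1 : ℝ) ^ 0 * ((-1 : ℝ) ^ 0 * dirDeriv (V 0) (dirDeriv (V 1) (eval₂ Ω (V 2) (V 3))) x +
      (-1 : ℝ) ^ 1 * dirDeriv (V 0) (dirDeriv (V 2) (eval₂ Ω (V 1) (V 3))) x +
      (-1 : ℝ) ^ 2 * dirDeriv (V 0) (dirDeriv (V 3) (eval₂ Ω (V 1) (V 2))) x) +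
    (-1 : ℝ) ^ 1 * ((-1 : ℝ) ^ 0 * dirDeriv (V 1) (dirDeriv (V 0) (eval₂ Ω (V 2) (V 3))) x +
      (-1 : ℝ) ^ 1 * dirDeriv (V 1) (dirDeriv (V 2) (eval₂ Ω (V 0) (V 3))) x +
      (-1 : ℝ) ^ 2 * dirDeriv (V 1) (dirDeriv (V 3) (eval₂ Ω (V 0) (V 2))) x) +
    (-1 : ℝ) ^ 2 * ((-1 : ℝ) ^ 0 * dirDeriv (V 2) (dirDeriv (V 0) (eval₂ Ω (V 1) (V 3))) x +
      (-1 : ℝ) ^ 1 * dirDeriv (V 2) (dirDeriv (V 1) (eval₂ Ω (V 0) (V 3))) x +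
      (-1 : ℝ) ^ 2 * dirDeriv (V 2) (dirDeriv (V 3) (eval₂ Ω (V 0) (V 1))) x) +
    (-1 : ℝ) ^ 3 * ((-1 : ℝ) ^ 0 * dirDeriv (V 3) (dirDeriv (V 0) (eval₂ Ω (V 1) (V 2))) x +
      (-1 : ℝ) ^ 1 * dirDeriv (V 3) (dirDeriv (V 1) (eval₂ Ω (V 0) (V 2))) x +
      (-1 : ℝ) ^ 2 * dirDeriv (V 3) (dirDeriv (V 2) (eval₂ Ω (V 0) (V 1))) x) = 0
  linear_combination hcomm 0 1 2 3 - hcomm 0 2 1 3 + hcomm 0 3 1 2 + hcomm 1 2 0 3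
    - hcomm 1 3 0 2 + hcomm 2 3 0 1

end Differential

/-! ### Closed 2-forms, endomorphisms and their torsion -/

section Torsion

theorem sharp_apply (P : Biv n M) (x : M) (α β : Module.Dual ℝ (Tan n x)) :
    β (sharp P x α) = P x α β := by
  simp [sharp]

theorem flat_apply (Ω : Form n M 2) (x : M) (u v : Tan n x) : flat Ω x u v = Ω x ![u, v] := by
  change Ω x (Matrix.vecCons u fun _ => v) = _
  congr 1
  funext i; fin_cases i <;> rfl

theorem contract₂_apply (φ : Form n M 3) (x : M) (u v w : Tan n x) :
    contract₂ φ x u v w = φ x ![u, v, w] := by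
  change φ x (Matrix.vecCons u (Matrix.vecCons v fun _ => w)) = _
  congr 1
  funext i; fin_cases i <;> rfl

/-- The `(1,1)` tensor field `P^♯ Ω^♭`. -/
def sharpFlat (P : Biv n M) (Ω : Form n M 2) : Endo n M := fun x => sharp P x ∘ₗ flat Ω x

theorem sharpFlat_apply (P : Biv n M) (Ω : Form n M 2) (x : M) (u : Tan n x) :
    sharpFlat P Ω x u = sharp P x (flat Ω x u) := rfl

theorem sharp_swap {P : Biv n M} (hP : ∀ x, (P x).IsAlt) (x : M)
    (α β : Module.Dual ℝ (Tan n x)) : β (sharp P x α) = -α (sharp P x β) := by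
  rw [sharp_apply, sharp_apply]
  exact ((hP x).neg_eq β α).symm

theorem form₂_sharp {P : Biv n M} (hP : ∀ x, (P x).IsAlt) (Ω : Form n M 2) (x : M)
    (α : Module.Dual ℝ (Tan n x)) (u : Tan n x) :
    Ω x ![sharp P x α, u] = α (sharpFlat P Ω x u) := by
  rw [form₂_swap, ← flat_apply, sharp_swap hP, neg_neg, sharpFlat_apply]

/-- `P^♯ Ω^♭` is symmetric with respect to `Ω`. -/
theorem form₂_sharpFlat {P : Biv n M} (hP : ∀ x, (P x).IsAlt) (Ω : Form n M 2) (x : M)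
    (u v : Tan n x) :
    Ω x ![sharpFlat P Ω x u, v] = Ω x ![u, sharpFlat P Ω x v] := by
  rw [sharpFlat_apply, form₂_sharp hP, flat_apply]

theorem form₃_cycle {V : Type*} [AddCommGroup V] [Module ℝ V] (η : V [⋀^Fin 3]→ₗ[ℝ] ℝ)
    (u v w : V) : η ![u, v, w] = η ![v, w, u] := by
  have h1 := η.map_swap ![v, u, w] (i := 0) (j := 1) (by decide)
  have h2 := η.map_swap ![v, w, u] (i := 1) (j := 2) (by decide)
  have e1 : (![v, u, w] ∘ Equiv.swap (0 : Fin 3) 1) = ![u, v, w] := by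
    funext i; fin_cases i <;> rfl
  have e2 : (![v, w, u] ∘ Equiv.swap (1 : Fin 3) 2) = ![v, u, w] := by
    funext i; fin_cases i <;> rfl
  rw [e1] at h1
  rw [e2] at h2
  rw [h1, h2, neg_neg]

theorem form₃_swap {V : Type*} [AddCommGroup V] [Module ℝ V] (η : V [⋀^Fin 3]→ₗ[ℝ] ℝ)
    (u v w : V) : η ![u, v, w] = -η ![u, w, v] := by
  have h2 := η.map_swap ![u, w, v] (i := 1) (j := 2) (by decide)
  have e2 : (![u, w, v] ∘ Equiv.swap (1 : Fin 3) 2) = ![u, v, w] := by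
    funext i; fin_cases i <;> rfl
  rwa [e2] at h2

/-- The 2-form `Ω(K²X, Y) + Ω(KX, KY) + Ω(X, K²Y)`, written as `½ (i_K i_K Ω + i_{K²} Ω)` so that it
is alternating by construction. -/
def quadraticInsert (K : Endo n M) (Ω : Form n M 2) : Form n M 2 :=
  (1 / 2 : ℝ) • (insertEndo K (insertEndo K Ω) + insertEndo (fun x => K x ∘ₗ K x) Ω)

theorem eval₂_quadraticInsert (K : Endo n M) (Ω : Form n M 2) (X Y : VField n M) :
    eval₂ (quadraticInsert K Ω) X Y = fun x => eval₂ Ω (act K (act K X)) Y x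
      + eval₂ Ω (act K X) (act K Y) x + eval₂ Ω X (act K (act K Y)) x := by
  funext x
  have h : eval₂ (quadraticInsert K Ω) X Y x = (1 / 2 : ℝ) *
    (insertEndo K (insertEndo K Ω) x ![X x, Y x]
      + insertEndo (fun x => K x ∘ₗ K x) Ω x ![X x, Y x]) := rfl
  rw [h]
  simp only [insertEndo_apply₂, eval₂, act_apply, LinearMap.comp_apply]
  ring

theorem form₂_quadraticInsert (K : Endo n M) (Ω : Form n M 2) (x : M) (u v : Tan n x) :
    quadraticInsert K Ω x ![u, v] = Ω x ![K x (K x u), v] + Ω x ![K x u, K x v]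
      + Ω x ![u, K x (K x v)] := by
  have h : quadraticInsert K Ω x ![u, v] = (1 / 2 : ℝ) *
    (insertEndo K (insertEndo K Ω) x ![u, v]
      + insertEndo (fun x => K x ∘ₗ K x) Ω x ![u, v]) := rfl
  rw [h]
  simp only [insertEndo_apply₂, LinearMap.comp_apply]
  ring

variable [IsManifold (𝓡 n) ∞ M]

theorem SmoothForm.quadraticInsert {Ω : Form n M 2} (hΩ : SmoothForm Ω) {K : Endo n M}
    (hK : SmoothEndo K) : SmoothForm (quadraticInsert K Ω) :=
  (((hΩ.insertEndo hK).insertEndo hK).add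
    (hΩ.insertEndo (N := fun x => K x ∘ₗ K x) fun X hX => hK _ (hK X hX))).smul _

variable [T2Space M]

/-- For a closed 2-form `Ω`, the form `i_K d i_K Ω` is the sum of an exact form and of the
contraction of `Ω` with the torsion of `K`. -/
theorem insertEndo_extd_insertEndo {K : Endo n M} (hK : SmoothEndo K) {Ω : Form n M 2}
    (hΩ : SmoothForm Ω) (hd : extd Ω = 0) {X Y Z : VField n M} (hX : SmoothV X) (hY : SmoothV Y)
    (hZ : SmoothV Z) (x : M) :
    eval₃ (insertEndo K (extd (insertEndo K Ω))) X Y Z x =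
      eval₃ (extd (quadraticInsert K Ω)) X Y Z x + Ω x ![torsion K X Y x, Z x]
        - Ω x ![torsion K X Z x, Y x] + Ω x ![torsion K Y Z x, X x] := by
  have hKX := hK.act hX
  have hKY := hK.act hY
  have hKZ := hK.act hZ
  have hKKX := hK.act hKX
  have hKKY := hK.act hKY
  have hKKZ := hK.act hKZ
  have hi := hΩ.insertEndo hK
  have h0 : ∀ {U V W : VField n M}, SmoothV U → SmoothV V → SmoothV W →
      cartan₂ (fun _ => LinearMap.id) Ω U V W x = 0 := fun hU hV hW => by
    rw [← eval₃_extd hΩ hU hV hW, hd]; rfl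
  -- `Ω` is closed: evaluate `dΩ` with `K` inserted in two of the three arguments.
  have h1 := h0 hKX hKY hZ
  have h2 := h0 hKX hY hKZ
  have h3 := h0 hX hKY hKZ
  rw [eval₃_insertEndo, eval₃_extd (hΩ.quadraticInsert hK) hX hY hZ]
  simp only [eval₃_extd hi hKX hY hZ, eval₃_extd hi hX hKY hZ, eval₃_extd hi hX hY hKZ]
  simp only [cartan₂, bracketN_id, act_id, eval₂_insertEndo, eval₂_quadraticInsert,
    insertEndo_apply₂, form₂_quadraticInsert, torsion_apply, act_apply, map_add, map_sub,
    form₂_add_left, form₂_sub_left] at h1 h2 h3 ⊢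
  have a2 : ∀ (U : VField n M) {f g : M → ℝ}, SmoothF n f → SmoothF n g →
    dirDeriv U (fun y => f y + g y) x = dirDeriv U f x + dirDeriv U g x := fun U _ _ hf hg =>
      dirDeriv_add U hf hg x
  have a3 : ∀ (U : VField n M) {f g h : M → ℝ}, SmoothF n f → SmoothF n g → SmoothF n h →
    dirDeriv U (fun y => f y + g y + h y) x =
      dirDeriv U f x + dirDeriv U g x + dirDeriv U h x := fun U _ _ _ hf hg hh => by
      rw [dirDeriv_add U (hf.add hg) hh, dirDeriv_add U hf hg]
  rw [a2 _ (hΩ.eval₂ hKY hZ) (hΩ.eval₂ hY hKZ), a2 _ (hΩ.eval₂ hKKX hZ) (hΩ.eval₂ hKX hKZ),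
    a2 _ (hΩ.eval₂ hKKX hY) (hΩ.eval₂ hKX hKY), a2 _ (hΩ.eval₂ hKKY hZ) (hΩ.eval₂ hKY hKZ),
    a2 _ (hΩ.eval₂ hKX hZ) (hΩ.eval₂ hX hKZ), a2 _ (hΩ.eval₂ hKX hKY) (hΩ.eval₂ hX hKKY),
    a2 _ (hΩ.eval₂ hKY hKZ) (hΩ.eval₂ hY hKKZ), a2 _ (hΩ.eval₂ hKX hKZ) (hΩ.eval₂ hX hKKZ),
    a2 _ (hΩ.eval₂ hKX hY) (hΩ.eval₂ hX hKY),
    a3 _ (hΩ.eval₂ hKKY hZ) (hΩ.eval₂ hKY hKZ) (hΩ.eval₂ hY hKKZ),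
    a3 _ (hΩ.eval₂ hKKX hZ) (hΩ.eval₂ hKX hKZ) (hΩ.eval₂ hX hKKZ),
    a3 _ (hΩ.eval₂ hKKX hY) (hΩ.eval₂ hKX hKY) (hΩ.eval₂ hX hKKY)]
  linear_combination h1 + h2 + h3

/-- If the torsion of `K` is `P^♯ ψ`, its contraction with `Ω` is `i_{P^♯ Ω^♭} ψ`. -/
theorem insertEndo_extd_insertEndo_of_torsion {P : Biv n M} (hP : ∀ x, (P x).IsAlt)
    {K : Endo n M} (hK : SmoothEndo K) {Ω : Form n M 2}
    (hΩ : SmoothForm Ω) (hd : extd Ω = 0) {ψ : Form n M 3}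
    (hψ : ∀ X Y : VField n M, SmoothV X → SmoothV Y → ∀ x,
      torsion K X Y x = sharp P x (contract₂ ψ x (X x) (Y x)))
    {X Y Z : VField n M} (hX : SmoothV X) (hY : SmoothV Y) (hZ : SmoothV Z) (x : M) :
    eval₃ (insertEndo K (extd (insertEndo K Ω))) X Y Z x =
      eval₃ (extd (quadraticInsert K Ω)) X Y Z x
        + eval₃ (insertEndo (sharpFlat P Ω) ψ) X Y Z x := by
  rw [insertEndo_extd_insertEndo hK hΩ hd hX hY hZ, hψ X Y hX hY, hψ X Z hX hZ, hψ Y Z hY hZ,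
    form₂_sharp hP, form₂_sharp hP, form₂_sharp hP, eval₃_insertEndo]
  simp only [contract₂_apply, eval₃, act_apply]
  rw [form₃_swap _ (X x) (Z x), form₃_cycle _ (sharpFlat P Ω x (X x)) (Y x)]
  ring

end Torsion

/-! ### Smooth 1-forms and the bracket of 1-forms on a Poisson manifold -/

section OneForms

/-- The vector field `P^♯ α`. -/
def sharpV (P : Biv n M) (α : OneForm n M) : VField n M := fun x => sharp P x (α x)

/-- The 1-form `i_X Ω`. -/
def flatV (Ω : Form n M 2) (X : VField n M) : OneForm n M := fun x => flat Ω x (X x)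

/-- A 1-form as an alternating form. -/
def OneForm.toForm (α : OneForm n M) : Form n M 1 :=
  fun x => AlternatingMap.ofSubsingleton ℝ (Tan n x) ℝ (0 : Fin 1) (α x)

variable [IsManifold (𝓡 n) ∞ M]

theorem SmoothOne.toForm {α : OneForm n M} (hα : SmoothOne α) : SmoothForm (OneForm.toForm α) :=
  fun X hX => hα (X 0) (hX 0)

theorem smoothOne_diff {f : M → ℝ} (hf : SmoothF n f) : SmoothOne (diff n f) :=
  fun _ hX => hX.dirDeriv hf

theorem SmoothOne.add {α β : OneForm n M} (hα : SmoothOne α) (hβ : SmoothOne β) :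
    SmoothOne (fun x => α x + β x) := fun X hX => (hα X hX).add (hβ X hX)

theorem SmoothOne.smul {f : M → ℝ} (hf : SmoothF n f) {α : OneForm n M} (hα : SmoothOne α) :
    SmoothOne (fun x => f x • α x) := fun X hX => hf.mul (hα X hX)

theorem smoothOne_zero : SmoothOne (fun _ => 0 : OneForm n M) := fun _ _ => smoothF_const 0

theorem smoothOne_sum {ι : Type*} (s : Finset ι) {α : ι → OneForm n M}
    (h : ∀ i ∈ s, SmoothOne (α i)) : SmoothOne (fun x => ∑ i ∈ s, α i x) := by
  intro X hX
  simp only [LinearMap.sum_apply]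
  exact smoothF_sum s fun i hi => h i hi X hX

theorem SmoothForm.flatV {Ω : Form n M 2} (hΩ : SmoothForm Ω) {X : VField n M} (hX : SmoothV X) :
    SmoothOne (flatV Ω X) := by
  intro Y hY
  have h := hΩ.eval₂ hX hY
  have h1 : (fun x => PoissonNijenhuis.flatV Ω X x (Y x)) = PoissonNijenhuis.eval₂ Ω X Y :=
    funext fun x => flat_apply Ω x (X x) (Y x)
  rwa [h1]

theorem SmoothOne.dualMap {α : OneForm n M} (hα : SmoothOne α) {N : Endo n M}
    (hN : SmoothEndo N) : SmoothOne (fun x => (N x).dualMap (α x)) :=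
  fun X hX => hα _ (hN X hX)

theorem IsCoordinates.eventually_eq_sum_diff {x₀ : M} {E : Fin n → VField n M} {ξ : Fin n → M → ℝ}
    (h : IsCoordinates x₀ E ξ) (α : OneForm n M) :
    ∀ᶠ x in 𝓝 x₀, α x = ∑ i, α x (E i x) • diff n (ξ i) x := by
  filter_upwards [h.eq_sum] with x hx
  ext v
  conv_lhs => rw [hx v]
  simp [mul_comm]

variable [T2Space M]

/-- A vector field is smooth if its pairings with smooth 1-forms are. -/
theorem smoothV_of_smoothOne {X : VField n M}
    (h : ∀ α : OneForm n M, SmoothOne α → SmoothF n (fun x => α x (X x))) : SmoothV X := by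
  refine smoothV_of_eventuallyEq fun x => ?_
  obtain ⟨E, ξ, hE⟩ := exists_isCoordinates (n := n) x
  refine ⟨fun y => ∑ i, diff n (ξ i) y (X y) • E i y,
    smoothV_sum _ fun i _ => SmoothV.smul (h _ (smoothOne_diff (hE.smoothF i))) (hE.smoothV i), ?_⟩
  filter_upwards [hE.eq_sum] with y hy using hy (X y)

theorem SmoothBiv.sharpV {P : Biv n M} (hP : SmoothBiv P) {α : OneForm n M} (hα : SmoothOne α) :
    SmoothV (sharpV P α) := by
  refine smoothV_of_smoothOne fun β hβ => ?_
  have h := hP α β hα hβ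
  have h1 : (fun x => β x (PoissonNijenhuis.sharpV P α x)) = fun x => P x (α x) (β x) :=
    funext fun x => sharp_apply P x (α x) (β x)
  rwa [h1]

theorem SmoothBiv.sharpFlat {P : Biv n M} (hP : SmoothBiv P) {Ω : Form n M 2}
    (hΩ : SmoothForm Ω) : SmoothEndo (sharpFlat P Ω) :=
  fun _ hX => hP.sharpV (hΩ.flatV hX)

/-- The formula `dα(X, Y) = X(α(Y)) - Y(α(X)) - α([X, Y])` for a 1-form `α`. -/
theorem extd_toForm {α : OneForm n M} (hα : SmoothOne α) {X Y : VField n M} (hX : SmoothV X)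
    (hY : SmoothV Y) (x : M) :
    extd (OneForm.toForm α) x ![X x, Y x] = dirDeriv X (fun y => α y (Y y)) x
      - dirDeriv Y (fun y => α y (X y)) x - α x (mlieBracket (𝓡 n) X Y x) := by
  have h := extd_apply hα.toForm ![X, Y] (by intro i; fin_cases i <;> assumption) x
  rw [vec₂_apply] at h
  rw [h, cartanSum_id, Fin.sum_univ_two]
  have hb : bracketSum (fun _ => LinearMap.id) (OneForm.toForm α) ![X, Y] x =
      -α x (mlieBracket (𝓡 n) X Y x) := by
    have i0 : (Finset.Ici (0 : Fin 1)) = {0} := by decide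
    simp only [bracketSum, bracketN_id]
    refine (Fin.sum_univ_one _).trans ?_
    rw [i0, Finset.sum_singleton]
    change (-1 : ℝ) ^ (0 + (0 + 1)) * α x (mlieBracket (𝓡 n) X Y x) = _
    ring
  rw [hb]
  change (-1 : ℝ) ^ 0 * dirDeriv X (fun y => α y (Y y)) x +
    (-1 : ℝ) ^ 1 * dirDeriv Y (fun y => α y (X y)) x + _ = _
  ring

theorem lieOne_apply {X : VField n M} (hX : SmoothV X) {α : OneForm n M} (hα : SmoothOne α)
    {Y : VField n M} (hY : SmoothV Y) (x : M) :
    lieOne X α x (Y x) = dirDeriv X (fun y => α y (Y y)) x - α x (mlieBracket (𝓡 n) X Y x) := by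
  have h : ∃ ζ : Module.Dual ℝ (Tan n x), ∀ Y : VField n M, SmoothV Y →
      ζ (Y x) = dirDeriv X (fun y => α y (Y y)) x - α x (mlieBracket (𝓡 n) X Y x) := by
    -- Cartan's formula `L_X α = i_X dα + d(α(X))` provides the covector.
    refine ⟨flat (extd (OneForm.toForm α)) x (X x) + diff n (fun y => α y (X y)) x,
      fun Y hY => ?_⟩
    rw [LinearMap.add_apply, flat_apply, extd_toForm hα hX hY, diff_apply]
    ring
  rw [lieOne, dif_pos h]
  exact h.choose_spec Y hY

/-- The bracket `L_{P^♯ α} β - L_{P^♯ β} α - d⟨β, P^♯ α⟩` of 1-forms. -/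
def bracketOne (P : Biv n M) (α β : OneForm n M) : OneForm n M := fun x =>
  lieOne (sharpV P α) β x - lieOne (sharpV P β) α x - diff n (fun y => β y (sharpV P α y)) x

theorem bracketOne_apply {P : Biv n M} (hP : SmoothBiv P) {α β : OneForm n M} (hα : SmoothOne α)
    (hβ : SmoothOne β) {Z : VField n M} (hZ : SmoothV Z) (x : M) :
    bracketOne P α β x (Z x) =
      dirDeriv (sharpV P α) (fun y => β y (Z y)) x - β x (mlieBracket (𝓡 n) (sharpV P α) Z x)
      - dirDeriv (sharpV P β) (fun y => α y (Z y)) x + α x (mlieBracket (𝓡 n) (sharpV P β) Z x)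
      - dirDeriv Z (fun y => β y (sharpV P α y)) x := by
  rw [bracketOne, LinearMap.sub_apply, LinearMap.sub_apply, lieOne_apply (hP.sharpV hα) hβ hZ,
    lieOne_apply (hP.sharpV hβ) hα hZ, diff_apply]
  ring

theorem bracketOne_swap {P : Biv n M} (hP : SmoothBiv P) (hA : ∀ x, (P x).IsAlt)
    {α β : OneForm n M} (hα : SmoothOne α) (hβ : SmoothOne β) (x : M) :
    bracketOne P α β x = -bracketOne P β α x := by
  refine covector_ext fun Z hZ => ?_
  have h1 : (fun y => β y (sharpV P α y)) = fun y => -α y (sharpV P β y) :=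
    funext fun y => sharp_swap hA y (α y) (β y)
  rw [LinearMap.neg_apply, bracketOne_apply hP hα hβ hZ, bracketOne_apply hP hβ hα hZ, h1,
    dirDeriv_neg]
  ring

theorem bracketOne_add_left {P : Biv n M} (hP : SmoothBiv P) {α γ β : OneForm n M}
    (hα : SmoothOne α) (hγ : SmoothOne γ) (hβ : SmoothOne β) (x : M) :
    bracketOne P (fun y => α y + γ y) β x = bracketOne P α β x + bracketOne P γ β x := by
  refine covector_ext fun Z hZ => ?_
  have h1 : sharpV P (fun y => α y + γ y) = fun y => sharpV P α y + sharpV P γ y :=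
    funext fun y => map_add (sharp P y) _ _
  have hα' := hP.sharpV hα
  have hγ' := hP.sharpV hγ
  rw [LinearMap.add_apply, bracketOne_apply hP (hα.add hγ) hβ hZ, bracketOne_apply hP hα hβ hZ,
    bracketOne_apply hP hγ hβ hZ, h1]
  simp only [LinearMap.add_apply, map_add]
  rw [dirDeriv_add_left, lie_add_left hα' hγ', map_add, dirDeriv_add _ (hα Z hZ) (hγ Z hZ),
    dirDeriv_add _ (hβ _ hα') (hβ _ hγ')]
  ring

theorem bracketOne_smul_left {P : Biv n M} (hP : SmoothBiv P) {f : M → ℝ} (hf : SmoothF n f)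
    {α β : OneForm n M} (hα : SmoothOne α) (hβ : SmoothOne β) (x : M) :
    bracketOne P (fun y => f y • α y) β x =
      f x • bracketOne P α β x - dirDeriv (sharpV P β) f x • α x := by
  refine covector_ext fun Z hZ => ?_
  have h1 : sharpV P (fun y => f y • α y) = fun y => f y • sharpV P α y :=
    funext fun y => map_smul (sharp P y) _ _
  have hα' := hP.sharpV hα
  rw [LinearMap.sub_apply, LinearMap.smul_apply, LinearMap.smul_apply,
    bracketOne_apply hP (hα.smul hf) hβ hZ, bracketOne_apply hP hα hβ hZ, h1]
  simp only [LinearMap.smul_apply, map_smul, smul_eq_mul]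
  rw [dirDeriv_smul_left, lie_smul_left hf hα', map_add, map_smul, map_smul,
    dirDeriv_mul _ hf (hα Z hZ), dirDeriv_mul _ hf (hβ _ hα')]
  simp only [smul_eq_mul]
  ring

theorem bracketOne_congr_left {P : Biv n M} (hP : SmoothBiv P) {α α' β : OneForm n M}
    (hα : SmoothOne α) (hα' : SmoothOne α') (hβ : SmoothOne β) {x : M}
    (h : ∀ᶠ y in 𝓝 x, α y = α' y) : bracketOne P α β x = bracketOne P α' β x := by
  refine covector_ext fun Z hZ => ?_
  have h1 : sharpV P α =ᶠ[𝓝 x] sharpV P α' := h.mono fun y hy => congrArg (sharp P y) hy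
  rw [bracketOne_apply hP hα hβ hZ, bracketOne_apply hP hα' hβ hZ,
    dirDeriv_congr_left _ h1.self_of_nhds,
    Filter.EventuallyEq.mlieBracket_vectorField_eq h1 (EventuallyEq.refl _ Z),
    dirDeriv_congr (sharpV P β) (f := fun y => α y (Z y)) (g := fun y => α' y (Z y))
      (h.mono fun y hy => by simp only [hy]),
    dirDeriv_congr Z (f := fun y => β y (sharpV P α y)) (g := fun y => β y (sharpV P α' y))
      (h1.mono fun y hy => congrArg (β y) hy), h.self_of_nhds]

/-- The bracket of 1-forms satisfies `[df, dg] = d{f, g}`. -/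
theorem bracketOne_diff {P : Biv n M} (hP : SmoothBiv P) (hA : ∀ x, (P x).IsAlt) {f g : M → ℝ}
    (hf : SmoothF n f) (hg : SmoothF n g) (x : M) :
    bracketOne P (diff n f) (diff n g) x = diff n (poissonBracket P f g) x := by
  refine covector_ext fun Z hZ => ?_
  have hXf := hP.sharpV (smoothOne_diff hf)
  have hXg := hP.sharpV (smoothOne_diff hg)
  have e1 : dirDeriv (sharpV P (diff n f)) g = poissonBracket P f g :=
    funext fun y => sharp_apply P y _ _
  have e2 : dirDeriv (sharpV P (diff n g)) f = fun y => -poissonBracket P f g y := by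
    rw [← e1]; exact funext fun y => sharp_swap hA y _ _
  have e3 : ∀ h : M → ℝ, (fun y => diff n h y (Z y)) = dirDeriv Z h := fun _ => rfl
  have e4 : (fun y => diff n g y (sharpV P (diff n f) y)) = poissonBracket P f g := e1
  rw [bracketOne_apply hP (smoothOne_diff hf) (smoothOne_diff hg) hZ, e3, e3, e4,
    diff_apply (X := mlieBracket (𝓡 n) _ _), diff_apply (X := mlieBracket (𝓡 n) _ _),
    dirDeriv_lie hXf hZ hg, dirDeriv_lie hXg hZ hf, e2, e1, dirDeriv_neg, diff_apply]
  ring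

theorem vector_ext_diff {x : M} {u v : Tan n x}
    (h : ∀ f : M → ℝ, SmoothF n f → diff n f x u = diff n f x v) : u = v := by
  obtain ⟨E, ξ, hE⟩ := exists_isCoordinates (n := n) x
  exact IsCoordinates.ext hE.eq_sum.self_of_nhds fun i => h _ (hE.smoothF i)

/-- The Jacobi identity, in terms of Hamiltonian vector fields. -/
theorem IsPoisson.lie_sharp_diff {P : Biv n M} (hP : IsPoisson P) {f g : M → ℝ}
    (hf : SmoothF n f) (hg : SmoothF n g) (x : M) :
    mlieBracket (𝓡 n) (sharpV P (diff n f)) (sharpV P (diff n g)) x =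
      sharp P x (bracketOne P (diff n f) (diff n g) x) := by
  refine vector_ext_diff fun h hh => ?_
  have e : ∀ k l : M → ℝ, dirDeriv (sharpV P (diff n k)) l = poissonBracket P k l := fun k l =>
    funext fun y => sharp_apply P y _ _
  have hs : ∀ (k l : M → ℝ) y, poissonBracket P k l y = -poissonBracket P l k y := fun k l y =>
    ((hP.alt y).neg_eq _ _).symm
  have hs' : poissonBracket P h f = fun y => -poissonBracket P f h y := funext (hs h f)
  rw [bracketOne_diff hP.smooth hP.alt hf hg, diff_apply,
    dirDeriv_lie (hP.smooth.sharpV (smoothOne_diff hf)) (hP.smooth.sharpV (smoothOne_diff hg)) hh,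
    e, e, e, e, sharp_apply]
  have hj := hP.jacobi f g h hf hg hh x
  have h1 := hs (poissonBracket P g h) f x
  have h2 := hs (poissonBracket P h f) g x
  have h3 : poissonBracket P g (poissonBracket P h f) x =
      -poissonBracket P g (poissonBracket P f h) x := by
    rw [← e g, ← e g, hs', dirDeriv_neg]
  change _ = poissonBracket P (poissonBracket P f g) h x
  linarith

/-- Both sides of `[P^♯ γ, P^♯ β] = P^♯ [γ, β]` are additive in `γ` and obey the same Leibniz rule,
so that the identity passes from the `γᵢ` to their combinations with smooth coefficients. -/
theorem IsPoisson.lie_sharp_combination {P : Biv n M} (hP : IsPoisson P) {ι : Type*}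
    (s : Finset ι) {γ : ι → OneForm n M} {a : ι → M → ℝ} {β : OneForm n M}
    (hγ : ∀ i, SmoothOne (γ i)) (ha : ∀ i, SmoothF n (a i)) (hβ : SmoothOne β) {x : M}
    (h : ∀ i, mlieBracket (𝓡 n) (sharpV P (γ i)) (sharpV P β) x =
      sharp P x (bracketOne P (γ i) β x)) :
    mlieBracket (𝓡 n) (sharpV P (fun y => ∑ i ∈ s, a i y • γ i y)) (sharpV P β) x =
      sharp P x (bracketOne P (fun y => ∑ i ∈ s, a i y • γ i y) β x) := by
  classical
  induction s using Finset.induction_on with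
  | empty =>
    have h0 : (fun _ => 0 : OneForm n M) = fun y => (0 : ℝ) • (fun _ => 0 : OneForm n M) y := by
      simp
    have h1 : sharpV P (fun _ => 0) = 0 := funext fun y => map_zero (sharp P y)
    simp only [Finset.sum_empty]
    rw [h1, mlieBracket_zero_left, h0, bracketOne_smul_left hP.smooth (smoothF_const 0)
      smoothOne_zero hβ]
    simp
  | insert i s hi ih =>
    simp only [Finset.sum_insert hi]
    have h1 := (hγ i).smul (ha i)
    have h2 := smoothOne_sum s fun j _ => (hγ j).smul (ha j)
    have e1 : sharpV P (fun y => a i y • γ i y + ∑ j ∈ s, a j y • γ j y) =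
        fun y => a i y • sharpV P (γ i) y + sharpV P (fun y => ∑ j ∈ s, a j y • γ j y) y := by
      funext y; simp only [sharpV, map_add, map_smul]
    rw [bracketOne_add_left hP.smooth h1 h2 hβ, map_add, ← ih, e1,
      lie_add_left ((hP.smooth.sharpV (hγ i)).smul (ha i)) (hP.smooth.sharpV h2),
      lie_smul_left (ha i) (hP.smooth.sharpV (hγ i)), h i,
      bracketOne_smul_left hP.smooth (ha i) (hγ i) hβ, map_sub, map_smul, map_smul]
    congr 1
    rw [sub_eq_add_neg, ← neg_smul, add_comm]
    rfl

/-- Locally every 1-form is a combination of the differentials of coordinate functions. -/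
theorem IsPoisson.lie_sharp_of_diff {P : Biv n M} (hP : IsPoisson P) {α β : OneForm n M}
    (hα : SmoothOne α) (hβ : SmoothOne β) (x : M)
    (h : ∀ f : M → ℝ, SmoothF n f → mlieBracket (𝓡 n) (sharpV P (diff n f)) (sharpV P β) x =
      sharp P x (bracketOne P (diff n f) β x)) :
    mlieBracket (𝓡 n) (sharpV P α) (sharpV P β) x = sharp P x (bracketOne P α β x) := by
  obtain ⟨E, ξ, hE⟩ := exists_isCoordinates (n := n) x
  have h1 := hE.eventually_eq_sum_diff α
  have ha : ∀ i, SmoothF n (fun y => α y (E i y)) := fun i => hα _ (hE.smoothV i)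
  have hγ : ∀ i, SmoothOne (diff n (ξ i)) := fun i => smoothOne_diff (hE.smoothF i)
  have h2 : sharpV P α =ᶠ[𝓝 x] sharpV P (fun y => ∑ i, α y (E i y) • diff n (ξ i) y) :=
    h1.mono fun y hy => congrArg (sharp P y) hy
  rw [bracketOne_congr_left hP.smooth hα (smoothOne_sum _ fun i _ => (hγ i).smul (ha i)) hβ h1]
  refine (Filter.EventuallyEq.mlieBracket_vectorField_eq (I := 𝓡 n) h2
    (EventuallyEq.refl _ (sharpV P β))).trans ?_
  exact hP.lie_sharp_combination _ hγ ha hβ fun i => h _ (hE.smoothF i)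

/-- `P^♯` intertwines the bracket of 1-forms with the bracket of vector fields. -/
theorem IsPoisson.lie_sharp {P : Biv n M} (hP : IsPoisson P) {α β : OneForm n M}
    (hα : SmoothOne α) (hβ : SmoothOne β) (x : M) :
    mlieBracket (𝓡 n) (sharpV P α) (sharpV P β) x = sharp P x (bracketOne P α β x) := by
  refine hP.lie_sharp_of_diff hα hβ x fun f hf => ?_
  have hdf := smoothOne_diff hf
  rw [lie_swap, bracketOne_swap hP.smooth hP.alt hdf hβ, map_neg]
  refine congrArg Neg.neg (hP.lie_sharp_of_diff hβ hdf x fun g hg => ?_)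
  exact hP.lie_sharp_diff hg hf x

end OneForms

/-! ### Compatibility and torsion of the deformed tensor field -/

section Deformation

theorem flat_sharp {P : Biv n M} (hP : ∀ x, (P x).IsAlt) (Ω : Form n M 2) (x : M)
    (α : Module.Dual ℝ (Tan n x)) : flat Ω x (sharp P x α) = (sharpFlat P Ω x).dualMap α := by
  ext u
  rw [flat_apply, form₂_sharp hP]
  rfl

theorem flatV_apply (Ω : Form n M 2) (X Y : VField n M) :
    (fun x => flatV Ω X x (Y x)) = eval₂ Ω X Y :=
  funext fun x => flat_apply Ω x (X x) (Y x)

variable [IsManifold (𝓡 n) ∞ M]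

theorem torsion_add {N A : Endo n M} (hN : SmoothEndo N) (hA : SmoothEndo A) {X Y : VField n M}
    (hX : SmoothV X) (hY : SmoothV Y) (x : M) :
    torsion (fun x => N x + A x) X Y x = torsion N X Y x + torsion A X Y x
      + (mlieBracket (𝓡 n) (act N X) (act A Y) x + mlieBracket (𝓡 n) (act A X) (act N Y) x
        - N x (bracketN A X Y x) - A x (bracketN N X Y x)) := by
  have h : ∀ U, act (fun x => N x + A x) U = fun y => act N U y + act A U y := fun _ => rfl
  have hNX := hN.act hX
  have hNY := hN.act hY
  have hAX := hA.act hX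
  have hAY := hA.act hY
  simp only [torsion_apply, bracketN_apply, h]
  rw [lie_add_left hNX hAX, lie_add_left hNX hAX, lie_add_right _ hNY hAY,
    lie_add_right _ hNY hAY, lie_add_right _ hNY hAY]
  simp only [map_add, map_sub, LinearMap.add_apply]
  abel

variable [T2Space M]

theorem lieOne_add_left {X Y : VField n M} (hX : SmoothV X) (hY : SmoothV Y) {α : OneForm n M}
    (hα : SmoothOne α) (x : M) :
    lieOne (fun y => X y + Y y) α x = lieOne X α x + lieOne Y α x := by
  refine covector_ext fun Z hZ => ?_
  rw [LinearMap.add_apply, lieOne_apply (hX.add hY) hα hZ, lieOne_apply hX hα hZ,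
    lieOne_apply hY hα hZ, dirDeriv_add_left, lie_add_left hX hY, map_add]
  ring

theorem lieOne_add_right {X : VField n M} (hX : SmoothV X) {α β : OneForm n M}
    (hα : SmoothOne α) (hβ : SmoothOne β) (x : M) :
    lieOne X (fun y => α y + β y) x = lieOne X α x + lieOne X β x := by
  refine covector_ext fun Z hZ => ?_
  rw [LinearMap.add_apply, lieOne_apply hX (hα.add hβ) hZ, lieOne_apply hX hα hZ,
    lieOne_apply hX hβ hZ]
  simp only [LinearMap.add_apply]
  rw [dirDeriv_add _ (hα Z hZ) (hβ Z hZ)]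
  ring

theorem Compatible.add {P : Biv n M} {N K : Endo n M} (hN : SmoothEndo N)
    (hK : SmoothEndo K) (cN : Compatible P N) (cK : Compatible P K) :
    Compatible P (fun x => N x + K x) where
  comm x := by
    have h : (N x + K x).dualMap = (N x).dualMap + (K x).dualMap :=
      LinearMap.ext fun α => LinearMap.comp_add _ _ _
    rw [h, LinearMap.add_comp, LinearMap.comp_add, cN.comm, cK.comm]
  lie α X hα hX x := by
    have h1 : (fun y => (N y + K y).dualMap (α y)) =
      fun y => (N y).dualMap (α y) + (K y).dualMap (α y) :=
      funext fun y => LinearMap.comp_add _ _ _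
    have h2 := cN.lie α X hα hX x
    have h3 := cK.lie α X hα hX x
    rw [h1, lieOne_add_right hX (hα.dualMap hN) (hα.dualMap hK)]
    simp only [LinearMap.add_apply]
    rw [lieOne_add_left (hN X hX) (hK X hX) hα, lie_add_right _ (hN X hX) (hK X hX), map_add,
      map_add]
    rw [← add_zero (0 : Tan n x)]
    nth_rw 1 [← h2]
    rw [← h3]
    abel

theorem cartan₂_id_eq_zero {Ω : Form n M 2} (hΩ : SmoothForm Ω) (hd : extd Ω = 0)
    {X Y Z : VField n M} (hX : SmoothV X) (hY : SmoothV Y) (hZ : SmoothV Z) (x : M) :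
    cartan₂ (fun _ => LinearMap.id) Ω X Y Z x = 0 := by
  rw [← eval₃_extd hΩ hX hY hZ, hd]
  rfl

theorem lieOne_flatV {Ω : Form n M 2} (hΩ : SmoothForm Ω) {X Y Z : VField n M} (hX : SmoothV X)
    (hY : SmoothV Y) (hZ : SmoothV Z) (x : M) :
    lieOne X (flatV Ω Y) x (Z x) =
      dirDeriv X (eval₂ Ω Y Z) x - Ω x ![Y x, mlieBracket (𝓡 n) X Z x] := by
  rw [lieOne_apply hX (hΩ.flatV hY) hZ, flatV_apply]
  exact congrArg _ (flat_apply _ _ _ _)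

/-- If `Ω` is closed, then `P` and `P^♯ Ω^♭` are compatible. -/
theorem IsPoisson.compatible_sharpFlat {P : Biv n M} (hP : IsPoisson P) {Ω : Form n M 2}
    (hΩ : SmoothForm Ω) (hd : extd Ω = 0) : Compatible P (sharpFlat P Ω) where
  comm x := by
    ext1 α
    exact congrArg (sharp P x) (flat_sharp hP.alt Ω x α)
  lie α X hα hX x := by
    have hU := hP.smooth.sharpV hα
    have hγ := hΩ.flatV hX
    have h1 : (fun y => (sharpFlat P Ω y).dualMap (α y)) = flatV Ω (sharpV P α) :=
      funext fun y => (flat_sharp hP.alt Ω y (α y)).symm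
    have h2 := hP.lie_sharp hα hγ x
    change (mlieBracket (𝓡 n) (sharpV P α) (sharpV P (flatV Ω X)) x -
      sharp P x (flat Ω x (mlieBracket (𝓡 n) (sharpV P α) X x))) -
      sharp P x (lieOne X (fun y => (sharpFlat P Ω y).dualMap (α y)) x) +
      sharp P x (lieOne (sharpV P (flatV Ω X)) α x) = 0
    rw [h2, h1, ← map_sub, ← map_sub, ← map_add]
    refine (congrArg (sharp P x) (covector_ext fun Z hZ => ?_)).trans (map_zero _)
    rw [LinearMap.add_apply, LinearMap.sub_apply, LinearMap.sub_apply, bracketOne,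
      LinearMap.sub_apply, LinearMap.sub_apply, lieOne_flatV hΩ hU hX hZ,
      lieOne_flatV hΩ hX hU hZ, diff_apply, flatV_apply, flat_apply, LinearMap.zero_apply,
      eval₂_swap_fun Ω X (sharpV P α), dirDeriv_neg, form₂_swap _ (X x),
      form₂_swap _ (sharpV P α x)]
    -- The covector which has to vanish is `i_X i_{P^♯ α} dΩ`.
    have h3 := cartan₂_id_eq_zero hΩ hd hU hX hZ x
    simp only [cartan₂, bracketN_id, act_id] at h3
    linarith

/-- The torsion of `P^♯ Ω^♭` for a closed 2-form `Ω`. -/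
theorem IsPoisson.torsion_sharpFlat {P : Biv n M} (hP : IsPoisson P) {Ω : Form n M 2}
    (hΩ : SmoothForm Ω) (hd : extd Ω = 0) {X Y : VField n M} (hX : SmoothV X) (hY : SmoothV Y)
    (x : M) :
    torsion (sharpFlat P Ω) X Y x = sharp P x (contract₂
      ((-1 / 2 : ℝ) • extd (insertEndo (sharpFlat P Ω) Ω)) x (X x) (Y x)) := by
  set A := sharpFlat P Ω with hA
  have sA : SmoothEndo A := hP.smooth.sharpFlat hΩ
  have hAX := sA.act hX
  have hAY := sA.act hY
  have h1 := hP.lie_sharp (hΩ.flatV hX) (hΩ.flatV hY) x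
  have e : ∀ U : VField n M, sharpV P (flatV Ω U) = act A U := fun _ => rfl
  rw [e, e] at h1
  rw [torsion_apply, h1, hA, sharpFlat_apply, ← map_sub]
  rw [← hA]
  refine congrArg (sharp P x) (covector_ext fun Z hZ => ?_)
  have hAZ := sA.act hZ
  -- The two sides differ by `dΩ(A X, Y, Z) + dΩ(X, A Y, Z)`, up to the symmetry of `A`.
  have h2 := cartan₂_id_eq_zero hΩ hd hAX hY hZ x
  have h3 := cartan₂_id_eq_zero hΩ hd hX hAY hZ x
  have s : ∀ u v, Ω x ![u, A x v] = Ω x ![A x u, v] := fun u v =>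
    (form₂_sharpFlat hP.alt Ω x u v).symm
  have s' : ∀ U V : VField n M, eval₂ Ω U (act A V) = eval₂ Ω (act A U) V := fun U V =>
    funext fun y => (form₂_sharpFlat hP.alt Ω y (U y) (V y)).symm
  have h4 : eval₃ (extd (insertEndo A Ω)) X Y Z x =
      2 * (dirDeriv X (eval₂ Ω (act A Y) Z) x - dirDeriv Y (eval₂ Ω (act A X) Z) x
        + dirDeriv Z (eval₂ Ω (act A X) Y) x - Ω x ![A x (mlieBracket (𝓡 n) X Y x), Z x]
        + Ω x ![A x (mlieBracket (𝓡 n) X Z x), Y x]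
        - Ω x ![A x (mlieBracket (𝓡 n) Y Z x), X x]) := by
    rw [eval₃_extd (hΩ.insertEndo sA) hX hY hZ]
    simp only [cartan₂, bracketN_id, act_id, eval₂_insertEndo, insertEndo_apply₂, s, s']
    rw [dirDeriv_add _ (hΩ.eval₂ hAY hZ) (hΩ.eval₂ hAY hZ),
      dirDeriv_add _ (hΩ.eval₂ hAX hZ) (hΩ.eval₂ hAX hZ),
      dirDeriv_add _ (hΩ.eval₂ hAX hY) (hΩ.eval₂ hAX hY)]
    ring
  have h5 : contract₂ ((-1 / 2 : ℝ) • extd (insertEndo A Ω)) x (X x) (Y x) (Z x) =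
      (-1 / 2 : ℝ) * eval₃ (extd (insertEndo A Ω)) X Y Z x := contract₂_apply _ _ _ _ _
  rw [h5, h4, LinearMap.sub_apply, bracketOne, LinearMap.sub_apply, LinearMap.sub_apply, e, e,
    lieOne_flatV hΩ hAX hY hZ, lieOne_flatV hΩ hAY hX hZ, diff_apply, flatV_apply, flat_apply,
    eval₂_swap_fun Ω Y (act A X), dirDeriv_neg, form₂_swap _ (X x), form₂_swap _ (Y x), form₂_sub_left,
    form₂_add_left]
  simp only [cartan₂, bracketN_id, act_id, s, s', act_apply] at h2 h3
  linarith

/-- The mixed part of the torsion of `N + P^♯ Ω^♭`. -/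
theorem Compatible.torsion_mixed {P : Biv n M} {N : Endo n M}
    (cN : Compatible P N) (hN : SmoothEndo N) {Ω : Form n M 2}
    (hΩ : SmoothForm Ω) (hd : extd Ω = 0) {X Y : VField n M} (hX : SmoothV X) (hY : SmoothV Y)
    (x : M) :
    mlieBracket (𝓡 n) (act N X) (act (sharpFlat P Ω) Y) x
        + mlieBracket (𝓡 n) (act (sharpFlat P Ω) X) (act N Y) x
        - N x (bracketN (sharpFlat P Ω) X Y x) - sharpFlat P Ω x (bracketN N X Y x) =
      sharp P x (contract₂ (dN N Ω) x (X x) (Y x)) := by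
  have hNX := hN.act hX
  have hNY := hN.act hY
  have hγ := hΩ.flatV hX
  have hδ := hΩ.flatV hY
  -- Compatibility for the pairs `(Ω^♭ Y, X)` and `(Ω^♭ X, Y)`.
  have c1 : mlieBracket (𝓡 n) (act (sharpFlat P Ω) Y) (act N X) x
      - N x (mlieBracket (𝓡 n) (act (sharpFlat P Ω) Y) X x)
      - sharp P x (lieOne X (fun y => (N y).dualMap (flatV Ω Y y)) x)
      + sharp P x (lieOne (act N X) (flatV Ω Y) x) = 0 := cN.lie _ X hδ hX x
  have c2 : mlieBracket (𝓡 n) (act (sharpFlat P Ω) X) (act N Y) x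
      - N x (mlieBracket (𝓡 n) (act (sharpFlat P Ω) X) Y x)
      - sharp P x (lieOne Y (fun y => (N y).dualMap (flatV Ω X y)) x)
      + sharp P x (lieOne (act N Y) (flatV Ω X) x) = 0 := cN.lie _ Y hγ hY x
  have c3 : N x (sharpFlat P Ω x (mlieBracket (𝓡 n) X Y x)) =
      sharp P x ((N x).dualMap (flat Ω x (mlieBracket (𝓡 n) X Y x))) :=
    LinearMap.congr_fun (cN.comm x) _
  have key : contract₂ (dN N Ω) x (X x) (Y x) =
      lieOne (act N X) (flatV Ω Y) x - lieOne X (fun y => (N y).dualMap (flatV Ω Y y)) x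
      + lieOne Y (fun y => (N y).dualMap (flatV Ω X y)) x - lieOne (act N Y) (flatV Ω X) x
      + (N x).dualMap (flat Ω x (mlieBracket (𝓡 n) X Y x)) - flat Ω x (bracketN N X Y x) := by
    refine covector_ext fun Z hZ => ?_
    have hNZ := hN.act hZ
    -- The two sides differ by `dΩ(X, Y, N Z)`.
    have h1 := cartan₂_id_eq_zero hΩ hd hX hY hNZ x
    have h2 : contract₂ (dN N Ω) x (X x) (Y x) (Z x) = cartan₂ N Ω X Y Z x := by
      rw [contract₂_apply, dN_eq hN hΩ, cartan₂_eq hN hΩ hX hY hZ]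
      rfl
    have e : ∀ U : VField n M, (fun y => (N y).dualMap (flatV Ω U y) (Z y)) =
        eval₂ Ω U (act N Z) := fun U => flatV_apply Ω U (act N Z)
    have e' : ∀ (U : VField n M) (v : Tan n x), (N x).dualMap (flatV Ω U x) v =
        Ω x ![U x, N x v] := fun U v => flat_apply Ω x (U x) (N x v)
    have e'' : ∀ u v : Tan n x, (N x).dualMap (flat Ω x u) v =
        Ω x ![u, N x v] := fun u v => flat_apply Ω x u (N x v)
    simp only [LinearMap.sub_apply, LinearMap.add_apply]
    rw [h2, lieOne_flatV hΩ hNX hY hZ, lieOne_flatV hΩ hNY hX hZ,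
      lieOne_apply hX (hδ.dualMap hN) hZ, lieOne_apply hY (hγ.dualMap hN) hZ, e, e, e', e', e'',
      flat_apply, form₂_swap _ (X x), form₂_swap _ (Y x), form₂_swap _ (X x), form₂_swap _ (Y x)]
    simp only [cartan₂, bracketN_apply, act_id, act_apply, form₂_add_left, form₂_sub_left,
      LinearMap.id_apply] at h1 ⊢
    linarith
  rw [key]
  simp only [map_sub, map_add]
  rw [bracketN_apply, map_sub, map_add, c3, sharpFlat_apply, lie_swap (act N X), lie_swap X]
  simp only [map_neg]
  rw [← sub_eq_zero]
  have c := congrArg₂ (fun u v => v - u) c1 c2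
  simp only [sub_zero] at c
  rw [← c]
  abel

end Deformation

/-! ### Wedge products of forms of low degree -/

section Wedge

open Equiv.Perm

/-- A signed sum over permutations, expanded along the value at `0`. -/
theorem sum_sign_perm_succ {k : ℕ} (F : (Fin (k + 1) → Fin (k + 1)) → ℝ) :
    ∑ σ : Equiv.Perm (Fin (k + 1)), ((sign σ : ℤ) : ℝ) * F σ =
      ∑ p : Fin (k + 1), (if p = 0 then 1 else -1 : ℝ) *
        ∑ τ : Equiv.Perm (Fin k), ((sign τ : ℤ) : ℝ) *
          F (Fin.cons p fun i => Equiv.swap 0 p (τ i).succ) := by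
  rw [← Equiv.sum_comp decomposeFin.symm, Fintype.sum_prod_type]
  refine Finset.sum_congr rfl fun p _ => ?_
  rw [Finset.mul_sum]
  refine Finset.sum_congr rfl fun τ _ => ?_
  have h : (decomposeFin.symm (p, τ) : Fin (k + 1) → Fin (k + 1)) =
      Fin.cons p fun i => Equiv.swap 0 p (τ i).succ := by
    funext i
    refine Fin.cases ?_ (fun i => ?_) i
    · simp
    · simp
  rw [h, Equiv.Perm.decomposeFin.symm_sign]
  split_ifs <;> simp

theorem sum_sign_perm_two (F : Fin 2 → Fin 2 → ℝ) :
    ∑ σ : Equiv.Perm (Fin 2), ((sign σ : ℤ) : ℝ) * F (σ 0) (σ 1) = F 0 1 - F 1 0 := by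
  have h := sum_sign_perm_succ (k := 1) fun s => F (s 0) (s 1)
  rw [h, Fin.sum_univ_two]
  simp
  rfl

theorem sum_sign_perm_three (F : Fin 3 → Fin 3 → Fin 3 → ℝ) :
    ∑ σ : Equiv.Perm (Fin 3), ((sign σ : ℤ) : ℝ) * F (σ 0) (σ 1) (σ 2) =
      F 0 1 2 - F 0 2 1 - F 1 0 2 + F 1 2 0 + F 2 0 1 - F 2 1 0 := by
  have h := sum_sign_perm_succ (k := 2) fun s => F (s 0) (s 1) (s 2)
  have h2 : ∀ p : Fin 3, ∑ τ : Equiv.Perm (Fin 2), ((sign τ : ℤ) : ℝ) *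
      F p (Equiv.swap 0 p (τ 0).succ) (Equiv.swap 0 p (τ 1).succ) =
      F p (Equiv.swap 0 p 1) (Equiv.swap 0 p 2) - F p (Equiv.swap 0 p 2) (Equiv.swap 0 p 1) :=
    fun p => sum_sign_perm_two fun a b => F p (Equiv.swap 0 p a.succ) (Equiv.swap 0 p b.succ)
  refine h.trans ?_
  change (∑ p : Fin 3, (if p = 0 then 1 else -1 : ℝ) *
    ∑ τ : Equiv.Perm (Fin 2), ((sign τ : ℤ) : ℝ) *
      F p (Equiv.swap 0 p (τ 0).succ) (Equiv.swap 0 p (τ 1).succ)) = _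
  simp only [h2]
  rw [Fin.sum_univ_three]
  rw [show Equiv.swap (0 : Fin 3) 0 1 = 1 by decide, show Equiv.swap (0 : Fin 3) 0 2 = 2 by decide,
    show Equiv.swap (0 : Fin 3) 1 1 = 0 by decide, show Equiv.swap (0 : Fin 3) 1 2 = 2 by decide,
    show Equiv.swap (0 : Fin 3) 2 1 = 1 by decide, show Equiv.swap (0 : Fin 3) 2 2 = 0 by decide,
    if_pos rfl, if_neg (by decide), if_neg (by decide)]
  ring

theorem sum_sign_perm_four (F : Fin 4 → Fin 4 → Fin 4 → Fin 4 → ℝ) :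
    ∑ σ : Equiv.Perm (Fin 4), ((sign σ : ℤ) : ℝ) * F (σ 0) (σ 1) (σ 2) (σ 3) =
      F 0 1 2 3 - F 0 1 3 2 - F 0 2 1 3 + F 0 2 3 1 + F 0 3 1 2 - F 0 3 2 1
      - F 1 0 2 3 + F 1 0 3 2 + F 1 2 0 3 - F 1 2 3 0 - F 1 3 0 2 + F 1 3 2 0
      + F 2 0 1 3 - F 2 0 3 1 - F 2 1 0 3 + F 2 1 3 0 + F 2 3 0 1 - F 2 3 1 0
      - F 3 0 1 2 + F 3 0 2 1 + F 3 1 0 2 - F 3 1 2 0 - F 3 2 0 1 + F 3 2 1 0 := by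
  have h := sum_sign_perm_succ (k := 3) fun s => F (s 0) (s 1) (s 2) (s 3)
  refine h.trans ?_
  have h3 := fun p : Fin 4 => sum_sign_perm_three fun a b c => F p (Equiv.swap 0 p a.succ)
    (Equiv.swap 0 p b.succ) (Equiv.swap 0 p c.succ)
  change (∑ p : Fin 4, (if p = 0 then 1 else -1 : ℝ) *
    ∑ τ : Equiv.Perm (Fin 3), ((sign τ : ℤ) : ℝ) *
      F p (Equiv.swap 0 p (τ 0).succ) (Equiv.swap 0 p (τ 1).succ)
        (Equiv.swap 0 p (τ 2).succ)) = _
  simp only [h3]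
  rw [Fin.sum_univ_four]
  have s0 : (0 : Fin 3).succ = 1 := rfl
  have s1 : (1 : Fin 3).succ = 2 := rfl
  have s2 : (2 : Fin 3).succ = 3 := rfl
  rw [s0, s1, s2, show Equiv.swap (0 : Fin 4) 0 1 = 1 by decide,
    show Equiv.swap (0 : Fin 4) 0 2 = 2 by decide, show Equiv.swap (0 : Fin 4) 0 3 = 3 by decide,
    show Equiv.swap (0 : Fin 4) 1 1 = 0 by decide, show Equiv.swap (0 : Fin 4) 1 2 = 2 by decide,
    show Equiv.swap (0 : Fin 4) 1 3 = 3 by decide, show Equiv.swap (0 : Fin 4) 2 1 = 1 by decide,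
    show Equiv.swap (0 : Fin 4) 2 2 = 0 by decide, show Equiv.swap (0 : Fin 4) 2 3 = 3 by decide,
    show Equiv.swap (0 : Fin 4) 3 1 = 1 by decide, show Equiv.swap (0 : Fin 4) 3 2 = 2 by decide,
    show Equiv.swap (0 : Fin 4) 3 3 = 0 by decide,
    if_pos rfl, if_neg (by decide), if_neg (by decide), if_neg (by decide)]
  ring

/-- The wedge product as a signed sum over all permutations. -/
theorem wedge_apply {p q : ℕ} (α : Form n M p) (β : Form n M q) (x : M)
    (v : Fin (p + q) → Tan n x) :
    (p.factorial * q.factorial : ℝ) * wedge α β x v =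
      ∑ σ : Equiv.Perm (Fin (p + q)), ((sign σ : ℤ) : ℝ) *
        (α x (fun i => v (σ (Fin.castAdd q i))) * β x (fun i => v (σ (Fin.natAdd p i)))) := by
  have h := congrArg (fun η => LinearMap.mul' ℝ ℝ (η (fun i => v (finSumFinEquiv i))))
    (MultilinearMap.domCoprod_alternization_eq (α x) (β x))
  simp only [AlternatingMap.smul_apply, Fintype.card_fin, map_nsmul] at h
  have h1 : LinearMap.mul' ℝ ℝ (((α x).domCoprod (β x)) (fun i => v (finSumFinEquiv i))) =
      wedge α β x v := rfl
  rw [h1, nsmul_eq_mul, MultilinearMap.alternatization_apply, map_sum] at h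
  push_cast at h
  rw [← h, ← Equiv.sum_comp (Equiv.permCongr finSumFinEquiv)]
  refine Finset.sum_congr rfl fun σ _ => ?_
  rw [Equiv.Perm.sign_permCongr]
  simp only [MultilinearMap.domDomCongr_apply, MultilinearMap.domCoprod_apply]
  rw [Units.smul_def, map_zsmul, LinearMap.mul'_apply, zsmul_eq_mul]
  simp [Equiv.permCongr_apply]

theorem wedge_one_two (β : Form n M 1) (Ω : Form n M 2) (x : M) (u v w : Tan n x) :
    wedge β Ω x ![u, v, w] =
      β x ![u] * Ω x ![v, w] - β x ![v] * Ω x ![u, w] + β x ![w] * Ω x ![u, v] := by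
  have h := wedge_apply β Ω x ![u, v, w]
  have e := sum_sign_perm_three fun a b c =>
    β x ![![u, v, w] a] * Ω x ![![u, v, w] b, ![u, v, w] c]
  have h1 : ∀ σ : Equiv.Perm (Fin 3), β x (fun i => ![u, v, w] (σ (Fin.castAdd 2 i))) *
      Ω x (fun i => ![u, v, w] (σ (Fin.natAdd 1 i))) =
      β x ![![u, v, w] (σ 0)] * Ω x ![![u, v, w] (σ 1), ![u, v, w] (σ 2)] := by
    intro σ
    congr 2
    · funext i; fin_cases i; rfl
    · funext i; fin_cases i <;> rfl
  simp only [h1] at h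
  rw [e] at h
  simp at h
  rw [form₂_swap _ w v, form₂_swap _ w u, form₂_swap _ v u] at h
  linarith

theorem wedge_two_one (Ω : Form n M 2) (β : Form n M 1) (x : M) (u v w : Tan n x) :
    wedge Ω β x ![u, v, w] =
      β x ![u] * Ω x ![v, w] - β x ![v] * Ω x ![u, w] + β x ![w] * Ω x ![u, v] := by
  have h := wedge_apply Ω β x ![u, v, w]
  have e := sum_sign_perm_three fun a b c =>
    Ω x ![![u, v, w] a, ![u, v, w] b] * β x ![![u, v, w] c]
  have h1 : ∀ σ : Equiv.Perm (Fin 3), Ω x (fun i => ![u, v, w] (σ (Fin.castAdd 1 i))) *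
      β x (fun i => ![u, v, w] (σ (Fin.natAdd 2 i))) =
      Ω x ![![u, v, w] (σ 0), ![u, v, w] (σ 1)] * β x ![![u, v, w] (σ 2)] := by
    intro σ
    congr 2
    · funext i; fin_cases i <;> rfl
    · funext i; fin_cases i; rfl
  simp only [h1] at h
  rw [e] at h
  simp at h
  rw [form₂_swap _ w v, form₂_swap _ w u, form₂_swap _ v u] at h
  linarith

theorem wedge_two_two (Ω : Form n M 2) (x : M) (a b c d : Tan n x) :
    wedge Ω Ω x ![a, b, c, d] =
      2 * (Ω x ![a, b] * Ω x ![c, d] - Ω x ![a, c] * Ω x ![b, d] + Ω x ![a, d] * Ω x ![b, c]) := by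
  have h := wedge_apply Ω Ω x ![a, b, c, d]
  have e := sum_sign_perm_four fun i j k l =>
    Ω x ![![a, b, c, d] i, ![a, b, c, d] j] * Ω x ![![a, b, c, d] k, ![a, b, c, d] l]
  have h1 : ∀ σ : Equiv.Perm (Fin 4), Ω x (fun i => ![a, b, c, d] (σ (Fin.castAdd 2 i))) *
      Ω x (fun i => ![a, b, c, d] (σ (Fin.natAdd 2 i))) =
      Ω x ![![a, b, c, d] (σ 0), ![a, b, c, d] (σ 1)] *
        Ω x ![![a, b, c, d] (σ 2), ![a, b, c, d] (σ 3)] := by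
    intro σ
    congr 2 <;> (funext i; fin_cases i <;> rfl)
  simp only [h1] at h
  rw [e] at h
  simp at h
  rw [form₂_swap _ b a, form₂_swap _ c a, form₂_swap _ d a, form₂_swap _ c b, form₂_swap _ d b,
    form₂_swap _ d c] at h
  linarith

end Wedge

/-! ### The Koszul bracket of a closed 2-form with itself -/

section Koszul

/-- The contraction with a bivector as a single sum: `Σⱼ Pⁱʲ eⱼ = P^♯ eⁱ`. -/
theorem contractBiv_apply {k : ℕ} (P : Biv n M) (η : Form n M (k + 2)) (x : M)
    (v : Fin k → Tan n x) :
    contractBiv P η x v = 1 / 2 * ∑ i, η x (Matrix.vecCons (Module.finBasis ℝ (Tan n x) i)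
      (Matrix.vecCons (sharp P x ((Module.finBasis ℝ (Tan n x)).coord i)) v)) := by
  set e := Module.finBasis ℝ (Tan n x) with he
  have h : contractBiv P η x = (1 / 2 : ℝ) • ∑ i, ((η x).curryLeft (e i)).curryLeft
      (sharp P x (e.coord i)) := by
    have h1 : contractBiv P η x = (1 / 2 : ℝ) • ∑ i, ∑ j, P x (e.coord i) (e.coord j) •
      ((η x).curryLeft (e i)).curryLeft (e j) := rfl
    rw [h1]
    congr 1
    refine Finset.sum_congr rfl fun i _ => ?_
    conv_rhs => rw [← e.sum_repr (sharp P x (e.coord i)), map_sum]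
    refine Finset.sum_congr rfl fun j _ => ?_
    rw [map_smul, ← sharp_apply]
    rfl
  rw [h, AlternatingMap.smul_apply, smul_eq_mul]
  exact congrArg _ (map_sum (AddMonoidHom.mk' (fun ζ : (Tan n x) [⋀^Fin k]→ₗ[ℝ] ℝ => ζ v)
    fun _ _ => rfl) _ _)

theorem contractBiv_zero {k : ℕ} (P : Biv n M) : contractBiv P (0 : Form n M (k + 2)) = 0 := by
  funext x
  ext v
  rw [contractBiv_apply]
  simp

/-- The function `i_P Ω`. -/
def contractScalar (P : Biv n M) (Ω : Form n M 2) : M → ℝ := fun x => contractBiv (k := 0) P Ω x ![]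

/-- The trace of an endomorphism may be computed in any frame. -/
theorem sum_coord_eq {V : Type*} [AddCommGroup V] [Module ℝ V] {ι κ : Type*} [Fintype ι]
    [Fintype κ] (e : ι → V) (a : ι → Module.Dual ℝ V) (f : κ → V) (b : κ → Module.Dual ℝ V)
    (he : ∀ v, v = ∑ i, a i v • e i) (hf : ∀ v, v = ∑ k, b k v • f k) (A : V →ₗ[ℝ] V) :
    ∑ i, a i (A (e i)) = ∑ k, b k (A (f k)) := by
  have h1 : ∀ i, a i (A (e i)) = ∑ k, b k (A (e i)) * a i (f k) := fun i => by
    conv_lhs => rw [hf (A (e i))]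
    simp
  have h2 : ∀ k, b k (A (f k)) = ∑ i, b k (A (e i)) * a i (f k) := fun k => by
    conv_lhs => rw [he (f k)]
    simp [mul_comm]
  simp only [h1, h2]
  exact Finset.sum_comm

/-- The function `i_P Ω` is `-½ tr (P^♯ Ω^♭)`. -/
theorem contractScalar_eq {P : Biv n M} (hP : ∀ x, (P x).IsAlt) (Ω : Form n M 2) (x : M) :
    contractScalar P Ω x = -1 / 2 * ∑ i, (Module.finBasis ℝ (Tan n x)).coord i
      (sharpFlat P Ω x (Module.finBasis ℝ (Tan n x) i)) := by
  have h : ∀ i, Ω x ![Module.finBasis ℝ (Tan n x) i,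
      sharp P x ((Module.finBasis ℝ (Tan n x)).coord i)] =
      -(Module.finBasis ℝ (Tan n x)).coord i
        (sharpFlat P Ω x (Module.finBasis ℝ (Tan n x) i)) := fun i => by
    rw [form₂_swap, form₂_sharp hP]
  rw [contractScalar, contractBiv_apply, Finset.sum_congr rfl fun i _ => h i,
    Finset.sum_neg_distrib]
  ring

/-- The formula `i_P (Ω ∧ Ω) = 2 (i_P Ω) Ω + i_{P^♯ Ω^♭} Ω`. -/
theorem contractBiv_wedge {P : Biv n M} (hP : ∀ x, (P x).IsAlt) (Ω : Form n M 2) (x : M)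
    (u v : Tan n x) : contractBiv (k := 2) P (wedge Ω Ω) x ![u, v] =
      2 * (contractScalar P Ω x * Ω x ![u, v]) + insertEndo (sharpFlat P Ω) Ω x ![u, v] := by
  set e := Module.finBasis ℝ (Tan n x) with he
  have h0 : contractScalar P Ω x = 1 / 2 * ∑ i, Ω x ![e i, sharp P x (e.coord i)] :=
    contractBiv_apply (k := 0) P Ω x ![]
  have h1 : ∀ u v : Tan n x, ∑ i, Ω x ![e i, u] * e.coord i v = Ω x ![v, u] := fun u v => by
    have h := congrArg (fun w => (flat Ω x).flip u w) (e.sum_repr v)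
    simp only [map_sum, map_smul, LinearMap.flip_apply, flat_apply, smul_eq_mul] at h
    rw [← h]
    exact Finset.sum_congr rfl fun i _ => mul_comm _ _
  have h2 : ∀ i, wedge Ω Ω x ![e i, sharp P x (e.coord i), u, v] =
      2 * (Ω x ![e i, sharp P x (e.coord i)] * Ω x ![u, v])
      - 2 * (Ω x ![e i, u] * e.coord i (sharpFlat P Ω x v))
      + 2 * (Ω x ![e i, v] * e.coord i (sharpFlat P Ω x u)) := fun i => by
    rw [wedge_two_two, form₂_sharp hP, form₂_sharp hP]
    ring
  rw [contractBiv_apply, Finset.sum_congr rfl fun i _ => h2 i, Finset.sum_add_distrib,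
    Finset.sum_sub_distrib, ← Finset.mul_sum, ← Finset.mul_sum, ← Finset.mul_sum, h1, h1,
    ← Finset.sum_mul, h0, insertEndo_apply₂,
    form₂_swap _ u (sharpFlat P Ω x v)]
  ring

variable [IsManifold (𝓡 n) ∞ M]

theorem SmoothForm.wedge_self {Ω : Form n M 2} (hΩ : SmoothForm Ω) : SmoothForm (wedge Ω Ω) := by
  intro X hX
  have h : (fun x => wedge Ω Ω x (fun i => X i x)) = fun x =>
      2 * (PoissonNijenhuis.eval₂ Ω (X 0) (X 1) x * PoissonNijenhuis.eval₂ Ω (X 2) (X 3) x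
        - PoissonNijenhuis.eval₂ Ω (X 0) (X 2) x * PoissonNijenhuis.eval₂ Ω (X 1) (X 3) x
        + PoissonNijenhuis.eval₂ Ω (X 0) (X 3) x * PoissonNijenhuis.eval₂ Ω (X 1) (X 2) x) := by
    funext x
    have e : (fun i => X i x) = ![X 0 x, X 1 x, X 2 x, X 3 x] := by
      funext i; fin_cases i <;> rfl
    rw [e]
    exact wedge_two_two Ω x _ _ _ _
  have s : ∀ i j, SmoothF n (PoissonNijenhuis.eval₂ Ω (X i) (X j)) := fun i j =>
    hΩ.eval₂ (hX i) (hX j)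
  rw [h]
  exact (smoothF_const 2).mul ((((s 0 1).mul (s 2 3)).sub ((s 0 2).mul (s 1 3))).add
    ((s 0 3).mul (s 1 2)))

variable [T2Space M]

theorem extd_zero_apply {α : Form n M 0} (hα : SmoothForm α) {X : VField n M} (hX : SmoothV X)
    (x : M) : extd α x ![X x] = dirDeriv X (fun y => α y ![]) x := by
  have h := extd_apply hα ![X] (fun i => by fin_cases i; exact hX) x
  have e : (fun i => (![X] : Fin 1 → VField n M) i x) = ![X x] := by
    funext i; fin_cases i; rfl
  rw [e] at h
  rw [h, cartanSum_id]
  refine (add_zero _).trans ((Fin.sum_univ_one _).trans ((one_mul _).trans ?_))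
  refine congrArg (fun f => dirDeriv X f x) (funext fun y => congrArg (α y) ?_)
  exact Subsingleton.elim _ _

/-- The square of a closed 2-form is closed. -/
theorem extd_wedge_self {Ω : Form n M 2} (hΩ : SmoothForm Ω) (hd : extd Ω = 0) :
    extd (wedge Ω Ω) = 0 := by
  funext x
  ext v
  obtain ⟨V, hV, hv, hc⟩ := exists_commuting_extension v
  have h0 : v = fun i => V i x := funext fun i => (hv i).symm
  rw [h0, extd_apply_of_commute hΩ.wedge_self hV hc.self_of_nhds]
  have s : ∀ i j, SmoothF n (eval₂ Ω (V i) (V j)) := fun i j => hΩ.eval₂ (hV i) (hV j)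
  have hd3 : ∀ i j k, dirDeriv (V i) (eval₂ Ω (V j) (V k)) x
      - dirDeriv (V j) (eval₂ Ω (V i) (V k)) x + dirDeriv (V k) (eval₂ Ω (V i) (V j)) x = 0 := by
    intro i j k
    have h := cartan₂_id_eq_zero hΩ hd (hV i) (hV j) (hV k) x
    have z : ∀ u : Tan n x, Ω x ![0, u] = 0 := fun u => (Ω x).map_coord_zero 0 rfl
    simpa only [cartan₂, bracketN_id, hc.self_of_nhds, z, act_id, sub_zero, add_zero] using h
  have hw : ∀ i a b c d, dirDeriv (V i) (fun y => wedge Ω Ω y ![V a y, V b y, V c y, V d y]) x =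
      2 * (dirDeriv (V i) (eval₂ Ω (V a) (V b)) x * eval₂ Ω (V c) (V d) x
        + eval₂ Ω (V a) (V b) x * dirDeriv (V i) (eval₂ Ω (V c) (V d)) x
        - dirDeriv (V i) (eval₂ Ω (V a) (V c)) x * eval₂ Ω (V b) (V d) x
        - eval₂ Ω (V a) (V c) x * dirDeriv (V i) (eval₂ Ω (V b) (V d)) x
        + dirDeriv (V i) (eval₂ Ω (V a) (V d)) x * eval₂ Ω (V b) (V c) x
        + eval₂ Ω (V a) (V d) x * dirDeriv (V i) (eval₂ Ω (V b) (V c)) x) := by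
    intro i a b c d
    have e : (fun y => wedge Ω Ω y ![V a y, V b y, V c y, V d y]) = fun y =>
      2 * (eval₂ Ω (V a) (V b) y * eval₂ Ω (V c) (V d) y
        - eval₂ Ω (V a) (V c) y * eval₂ Ω (V b) (V d) y
        + eval₂ Ω (V a) (V d) y * eval₂ Ω (V b) (V c) y) :=
      funext fun y => wedge_two_two Ω y _ _ _ _
    rw [e, dirDeriv_const_mul _ _ ((((s a b).mul (s c d)).sub ((s a c).mul (s b d))).add
      ((s a d).mul (s b c))), dirDeriv_add _ (((s a b).mul (s c d)).sub ((s a c).mul (s b d)))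
      ((s a d).mul (s b c)), dirDeriv_sub _ ((s a b).mul (s c d)) ((s a c).mul (s b d)),
      dirDeriv_mul _ (s a b) (s c d), dirDeriv_mul _ (s a c) (s b d),
      dirDeriv_mul _ (s a d) (s b c)]
    ring
  have e : ∀ j : Fin 5, (fun y => wedge Ω Ω y (fun k => j.removeNth V k y)) = fun y =>
      wedge Ω Ω y ![j.removeNth V 0 y, j.removeNth V 1 y, j.removeNth V 2 y,
        j.removeNth V 3 y] := by
    intro j
    funext y
    refine congrArg (wedge Ω Ω y) ?_
    funext i; fin_cases i <;> rfl
  simp only [e]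
  refine (Fin.sum_univ_five _).trans ?_
  change (-1 : ℝ) ^ 0 * dirDeriv (V 0) (fun y => wedge Ω Ω y ![V 1 y, V 2 y, V 3 y, V 4 y]) x +
    (-1 : ℝ) ^ 1 * dirDeriv (V 1) (fun y => wedge Ω Ω y ![V 0 y, V 2 y, V 3 y, V 4 y]) x +
    (-1 : ℝ) ^ 2 * dirDeriv (V 2) (fun y => wedge Ω Ω y ![V 0 y, V 1 y, V 3 y, V 4 y]) x +
    (-1 : ℝ) ^ 3 * dirDeriv (V 3) (fun y => wedge Ω Ω y ![V 0 y, V 1 y, V 2 y, V 4 y]) x +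
    (-1 : ℝ) ^ 4 * dirDeriv (V 4) (fun y => wedge Ω Ω y ![V 0 y, V 1 y, V 2 y, V 3 y]) x = 0
  simp only [hw]
  -- The coefficients are the signs of the shuffles in `d(Ω ∧ Ω) = 2 dΩ ∧ Ω`.
  linear_combination 2 * (eval₂ Ω (V 3) (V 4) x * hd3 0 1 2 - eval₂ Ω (V 2) (V 4) x * hd3 0 1 3
    + eval₂ Ω (V 2) (V 3) x * hd3 0 1 4 + eval₂ Ω (V 1) (V 4) x * hd3 0 2 3
    - eval₂ Ω (V 1) (V 3) x * hd3 0 2 4 + eval₂ Ω (V 1) (V 2) x * hd3 0 3 4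
    - eval₂ Ω (V 0) (V 4) x * hd3 1 2 3 + eval₂ Ω (V 0) (V 3) x * hd3 1 2 4
    - eval₂ Ω (V 0) (V 2) x * hd3 1 3 4 + eval₂ Ω (V 0) (V 1) x * hd3 2 3 4)

theorem IsPoisson.smoothF_contractScalar {P : Biv n M} (hP : IsPoisson P) {Ω : Form n M 2}
    (hΩ : SmoothForm Ω) : SmoothF n (contractScalar P Ω) := by
  refine smoothF_of_eventuallyEq fun x => ?_
  obtain ⟨E, ξ, hE⟩ := exists_isCoordinates (n := n) x
  refine ⟨fun y => -1 / 2 * ∑ i, diff n (ξ i) y (act (sharpFlat P Ω) (E i) y),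
    (smoothF_const _).mul (smoothF_sum _ fun i _ => smoothOne_diff (hE.smoothF i) _
      (hP.smooth.sharpFlat hΩ _ (hE.smoothV i))), ?_⟩
  filter_upwards [hE.eq_sum] with y hy
  rw [contractScalar_eq hP.alt]
  refine congrArg _ (sum_coord_eq _ _ _ _ (fun v => ?_) hy _)
  exact ((Module.finBasis ℝ (Tan n y)).sum_repr v).symm

/-- The formula `d(f Ω) = df ∧ Ω` for a closed 2-form `Ω`. -/
theorem eval₃_extd_smul {f : M → ℝ} (hf : SmoothF n f) {Ω : Form n M 2} (hΩ : SmoothForm Ω)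
    (hd : extd Ω = 0) {X Y Z : VField n M} (hX : SmoothV X) (hY : SmoothV Y) (hZ : SmoothV Z)
    (x : M) : eval₃ (extd (fun y => f y • Ω y)) X Y Z x =
      dirDeriv X f x * Ω x ![Y x, Z x] - dirDeriv Y f x * Ω x ![X x, Z x]
        + dirDeriv Z f x * Ω x ![X x, Y x] := by
  have hs : SmoothForm (fun y => f y • Ω y) := fun X hX => hf.mul (hΩ X hX)
  have h := cartan₂_id_eq_zero hΩ hd hX hY hZ x
  have e : ∀ U V : VField n M, eval₂ (fun y => f y • Ω y) U V = fun y => f y * eval₂ Ω U V y :=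
    fun _ _ => rfl
  rw [eval₃_extd hs hX hY hZ]
  simp only [cartan₂, e, act_id, AlternatingMap.smul_apply, smul_eq_mul] at h ⊢
  rw [dirDeriv_mul _ hf (hΩ.eval₂ hY hZ), dirDeriv_mul _ hf (hΩ.eval₂ hX hZ),
    dirDeriv_mul _ hf (hΩ.eval₂ hX hY)]
  simp only [eval₂]
  linear_combination f x * h

/-- The Koszul bracket of a closed 2-form `Ω` with itself is `-d(i_{P^♯ Ω^♭} Ω)`. -/
theorem IsPoisson.koszul_self {P : Biv n M} (hP : IsPoisson P) {Ω : Form n M 2}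
    (hΩ : SmoothForm Ω) (hd : extd Ω = 0) :
    koszul P Ω Ω = -extd (insertEndo (sharpFlat P Ω) Ω) := by
  have hf := hP.smoothF_contractScalar hΩ
  have hs : SmoothForm (fun y => contractScalar P Ω y • Ω y) := fun X hX => hf.mul (hΩ X hX)
  have hi := hΩ.insertEndo (hP.smooth.sharpFlat hΩ)
  have h1 : contractBiv (k := 2) P (wedge Ω Ω) =
      (2 : ℝ) • (fun y => contractScalar P Ω y • Ω y) + insertEndo (sharpFlat P Ω) Ω := by
    funext x
    ext v
    have e : v = ![v 0, v 1] := by funext i; fin_cases i <;> rfl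
    rw [e]
    exact contractBiv_wedge hP.alt Ω x _ _
  have h2 : koszulOp (k := 2) P (wedge Ω Ω) =
      -((2 : ℝ) • extd (fun y => contractScalar P Ω y • Ω y)
        + extd (insertEndo (sharpFlat P Ω) Ω)) := by
    have h3 : koszulOp (k := 2) P (wedge Ω Ω) =
      contractBiv (k := 3) P (extd (q := 4) (wedge (p := 2) (q := 2) Ω Ω))
        - extd (contractBiv (k := 2) P (wedge Ω Ω)) := rfl
    rw [h3, show extd (q := 4) (wedge (p := 2) (q := 2) Ω Ω) = 0 from extd_wedge_self hΩ hd, h1,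
      extd_add (hs.smul 2) hi, extd_smul 2 hs]
    refine (congrArg (fun η => η - _) (contractBiv_zero P)).trans (zero_sub _)
  have h0 : SmoothForm (contractBiv (k := 0) P Ω) := fun X _ => by
    have e : (fun x => contractBiv (k := 0) P Ω x fun i => X i x) = contractScalar P Ω :=
      funext fun x => congrArg (contractBiv (k := 0) P Ω x) (Subsingleton.elim _ _)
    rwa [e]
  have h4 : koszulOp (k := 0) P Ω = -extd (contractBiv (k := 0) P Ω) := by
    rw [koszulOp, hd]
    exact (congrArg (fun η => η - _) (contractBiv_zero P)).trans (zero_sub _)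
  have h5 : ∀ {X : VField n M}, SmoothV X → ∀ x, koszulOp (k := 0) P Ω x ![X x] =
      -dirDeriv X (contractScalar P Ω) x := fun hX x => by
    rw [h4]
    exact congrArg Neg.neg (extd_zero_apply h0 hX x)
  funext x
  refine form_ext fun X hX => ?_
  have e : (fun i => X i x) = ![X 0 x, X 1 x, X 2 x] := by
    funext i; fin_cases i <;> rfl
  rw [e]
  -- The terms `df ∧ Ω` with `f = i_P Ω` cancel.
  have h6 : koszul P Ω Ω x ![X 0 x, X 1 x, X 2 x] =
      -(2 * eval₃ (extd (fun y => contractScalar P Ω y • Ω y)) (X 0) (X 1) (X 2) x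
        + extd (insertEndo (sharpFlat P Ω) Ω) x ![X 0 x, X 1 x, X 2 x])
      - wedge (koszulOp (k := 0) P Ω) Ω x ![X 0 x, X 1 x, X 2 x]
      - wedge Ω (koszulOp (k := 0) P Ω) x ![X 0 x, X 1 x, X 2 x] := by
    rw [koszul, h2]
    rfl
  have h7 := wedge_one_two (koszulOp (k := 0) P Ω) Ω x (X 0 x) (X 1 x) (X 2 x)
  have h8 := wedge_two_one Ω (koszulOp (k := 0) P Ω) x (X 0 x) (X 1 x) (X 2 x)
  rw [h5 (hX 0), h5 (hX 1), h5 (hX 2)] at h7 h8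
  rw [h6, eval₃_extd_smul hf hΩ hd (hX 0) (hX 1) (hX 2)]
  refine (congrArg₂ (fun a b => _ - a - b) h7 h8).trans ?_
  rw [Pi.neg_apply, AlternatingMap.neg_apply]
  ring

end Koszul

/-! ### The Poisson quasi-Nijenhuis structure -/

section QuasiNijenhuis

variable [IsManifold (𝓡 n) ∞ M]

theorem IsPqN.isPN {P : Biv n M} {N : Endo n M} {φ : Form n M 3} (h : IsPqN P N φ) (hφ : φ = 0) :
    IsPN P N := by
  refine ⟨h.poisson, h.smooth, h.compatible, fun X Y hX hY x => ?_⟩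
  rw [h.torsion_eq X Y hX hY, hφ]
  exact map_zero (sharp P x)

variable [T2Space M]

/-- If `Ω` is closed and the torsion of `K` is `P^♯ ψ`, then `i_K d i_K Ω` and the contraction of
`ψ` with `P^♯ Ω^♭` differ by an exact form. -/
theorem insertEndo_extd_insertEndo_eq {P : Biv n M} (hP : ∀ x, (P x).IsAlt)
    {K : Endo n M} (hK : SmoothEndo K) {Ω : Form n M 2}
    (hΩ : SmoothForm Ω) (hd : extd Ω = 0) {ψ : Form n M 3}
    (hψ : ∀ X Y : VField n M, SmoothV X → SmoothV Y → ∀ x,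
      torsion K X Y x = sharp P x (contract₂ ψ x (X x) (Y x))) :
    insertEndo K (extd (insertEndo K Ω)) =
      extd (quadraticInsert K Ω) + insertEndo (sharpFlat P Ω) ψ := by
  funext x
  refine form_ext fun X hX => ?_
  have e : (fun i => X i x) = ![X 0 x, X 1 x, X 2 x] := by
    funext i; fin_cases i <;> rfl
  rw [e]
  exact insertEndo_extd_insertEndo_of_torsion hP hK hΩ hd hψ (hX 0) (hX 1) (hX 2) x

theorem IsPN.torsion_deform {P : Biv n M} {N : Endo n M} (h : IsPN P N) {Ω : Form n M 2}
    (hΩ : SmoothForm Ω) (hd : extd Ω = 0) {X Y : VField n M} (hX : SmoothV X) (hY : SmoothV Y)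
    (x : M) : torsion (deform P N Ω) X Y x =
      sharp P x (contract₂ (dN N Ω + (1 / 2 : ℝ) • koszul P Ω Ω) x (X x) (Y x)) := by
  have h1 := torsion_add h.smooth (h.poisson.smooth.sharpFlat hΩ) hX hY x
  rw [h.torsion_eq_zero X Y hX hY, h.poisson.torsion_sharpFlat hΩ hd hX hY,
    h.compatible.torsion_mixed h.smooth hΩ hd hX hY, zero_add, ← map_add] at h1
  refine h1.trans (congrArg (sharp P x) ?_)
  ext w
  simp only [LinearMap.add_apply, contract₂_apply, h.poisson.koszul_self hΩ hd, Pi.add_apply,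
    Pi.smul_apply, Pi.neg_apply, AlternatingMap.add_apply, AlternatingMap.smul_apply,
    AlternatingMap.neg_apply, smul_eq_mul]
  ring

/-- The form `d_N Ω + ½ [Ω, Ω]_P` is exact. -/
theorem IsPN.form_eq_extd {P : Biv n M} {N : Endo n M} (h : IsPN P N) {Ω : Form n M 2}
    (hΩ : SmoothForm Ω) (hd : extd Ω = 0) :
    dN N Ω + (1 / 2 : ℝ) • koszul P Ω Ω = (-1 : ℝ) • extd (insertEndo N Ω)
      + (-1 / 2 : ℝ) • extd (insertEndo (sharpFlat P Ω) Ω) := by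
  rw [dN_eq_neg h.smooth hΩ hd, h.poisson.koszul_self hΩ hd]
  module

theorem IsPN.isPqN_deform {P : Biv n M} {N : Endo n M} (h : IsPN P N) {Ω : Form n M 2}
    (hΩ : SmoothForm Ω) (hd : extd Ω = 0) :
    IsPqN P (deform P N Ω) (dN N Ω + (1 / 2 : ℝ) • koszul P Ω Ω) := by
  have sN := h.smooth
  have sA := h.poisson.smooth.sharpFlat hΩ
  have sK : SmoothEndo (deform P N Ω) := sN.add sA
  have iN := hΩ.insertEndo sN
  have iA := hΩ.insertEndo sA
  have hφ : dN N Ω + (1 / 2 : ℝ) • koszul P Ω Ω =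
      extd ((-1 : ℝ) • insertEndo N Ω + (-1 / 2 : ℝ) • insertEndo (sharpFlat P Ω) Ω) := by
    rw [extd_add (iN.smul _) (iA.smul _), extd_smul _ iN, extd_smul _ iA, h.form_eq_extd hΩ hd]
  have sρ := (iN.smul (-1)).add (iA.smul (-1 / 2))
  refine ⟨h.poisson, sK, ?_, h.compatible.add sN sA (h.poisson.compatible_sharpFlat hΩ hd), ?_, ?_,
    fun X Y hX hY x => h.torsion_deform hΩ hd hX hY x⟩
  · rw [hφ]
    exact sρ.extd
  · rw [hφ]
    exact extd_extd sρ
  · have qN := hΩ.quadraticInsert sN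
    have qA := hΩ.quadraticInsert sA
    have qK := hΩ.quadraticInsert sK
    -- Put `A = P^♯ Ω^♭`. The torsions of `N`, `A` and `N + A` are the images under `P^♯` of `0`,
    -- `-½ d i_A Ω` and `φ`, which gives three equations for `i_N d i_N Ω`, `i_A d i_A Ω` and
    -- `i_N d i_A Ω + 2 i_A d i_N Ω` modulo exact forms.
    have e1 := insertEndo_extd_insertEndo_eq h.poisson.alt sN hΩ hd (ψ := 0)
      fun X Y hX hY x => by
        rw [h.torsion_eq_zero X Y hX hY]
        exact (map_zero (sharp P x)).symm
    have e2 := insertEndo_extd_insertEndo_eq h.poisson.alt sA hΩ hd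
      fun X Y hX hY x => h.poisson.torsion_sharpFlat hΩ hd hX hY x
    have e3 := insertEndo_extd_insertEndo_eq h.poisson.alt sK hΩ hd
      fun X Y hX hY x => h.torsion_deform hΩ hd hX hY x
    have hK : ∀ {p : ℕ} (η : Form n M p), insertEndo (deform P N Ω) η =
        insertEndo N η + insertEndo (sharpFlat P Ω) η := insertEndo_add_left N (sharpFlat P Ω)
    rw [h.form_eq_extd hΩ hd, hK, hK, extd_add iN iA] at e3
    simp only [insertEndo_add_right, insertEndo_smul_right, insertEndo_zero_right] at e1 e2 e3
    have key : insertEndo (deform P N Ω) (dN N Ω + (1 / 2 : ℝ) • koszul P Ω Ω) =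
        extd ((-1 / 2 : ℝ) • quadraticInsert N Ω + (-1 / 2 : ℝ) • quadraticInsert (deform P N Ω) Ω
          + (1 / 6 : ℝ) • quadraticInsert (sharpFlat P Ω) Ω) := by
      rw [extd_add ((qN.smul _).add (qK.smul _)) (qA.smul _), extd_add (qN.smul _) (qK.smul _),
        extd_smul _ qN, extd_smul _ qA, extd_smul _ qK, h.form_eq_extd hΩ hd, hK]
      simp only [insertEndo_add_right, insertEndo_smul_right]
      linear_combination (norm := module) (-1 / 2 : ℝ) • e1 + (1 / 6 : ℝ) • e2 + (-1 / 2 : ℝ) • e3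
    rw [key]
    exact extd_extd (((qN.smul _).add (qK.smul _)).add (qA.smul _))

end QuasiNijenhuis

end PoissonNijenhuis

end

theorem theorem1 {n : ℕ} {M : Type*} [TopologicalSpace M]
    [ChartedSpace (EuclideanSpace ℝ (Fin n)) M] [IsManifold (𝓡 n) ∞ M]
    [T2Space M] [SecondCountableTopology M]
    (P : Biv n M) (N : Endo n M) (hPN : IsPN P N)
    (Ω : Form n M 2) (hΩ : SmoothForm Ω) (hclosed : extd Ω = 0) :
    IsPqN P (deform P N Ω) (dN N Ω + (1 / 2 : ℝ) • koszul P Ω Ω) ∧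
      (dN N Ω + (1 / 2 : ℝ) • koszul P Ω Ω = 0 → IsPN P (deform P N Ω)) := by
  have h := hPN.isPqN_deform hΩ hclosed
  exact ⟨h, h.isPN⟩
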